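/- Let $M$ be an oriented Riemannian manifold of dimension $4k$ with volume form $\epsilon$, and let $\xi\to M$ be a smooth real vector bundle of rank $l\ge 2k$ with a smooth inner product $h$ and a smooth connection $D$ compatible with $h$. Let $R(X,Y)s=(D_XD_Y-D_YD_X-D_{[X,Y]})s$ be the curvature. In a local frame $\{s_a\}$ of $\xi$ with dual frame $\{s^a\}$, let $R^a{}_b$ be the matrix of $2$-forms $R^a{}_b(X,Y)=s^a(R(X,Y)s_b)$, and let $$p_k(\xi)=\frac{1}{(2\pi)^{2k}}\sum_{1\le a_1<\dots<a_{2k}\le l}\ \sum_{\sigma\in S_{2k}}(-1)^{\sigma}\,R^{a_1}{}_{a_{\sigma(1)}}\wedge\dots\wedge R^{a_{2k}}{}_{a_{\sigma(2k)}}$$ be the Chern–Weil form of the $k$-th Pontryagin class. Regard $R$ as the element of $\Lambda^2T^*M\otimes\Lambda^2\xi^*$ given by $R(X,Y,s,t)=h(R(X,Y)t,s)$, and let $R^k\in\Lambda^{2k}T^*M\otimes\Lambda^{2k}\xi^*$ be its $k$-th power for the product $(\phi_1\otimes\psi_1)\wedge(\phi_2\otimes\psi_2)=(\phi_1\wedge\phi_2)\otimes(\psi_1\wedge\psi_2)$.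 The spaces $\Lambda^p$ carry the inner products for which the $e^{i_1}\wedge\dots\wedge e^{i_p}$, $i_1<\dots<i_p$, are orthonormal whenever $\{e^i\}$ is an orthonormal basis, and tensor products carry the induced inner product. The Hodge star is defined by $\alpha\wedge *\beta=(\alpha,\beta)\epsilon$. Let $(R^k)^{\pm}$ be the components of $R^k$ in $\Lambda^{2k}_\pm T^*M\otimes\Lambda^{2k}\xi^*$, where $\Lambda^{2k}_\pm T^*M$ is the $\pm1$-eigenspace of $*$ on $\Lambda^{2k}T^*M$. Then, at every point of $M$ and in every local frame of $\xi$, $$p_k(\xi)=\frac{1}{(2\pi)^{2k}(k!)^2}\left(|(R^k)^+|^2-|(R^k)^-|^2\right)\epsilon .$$ If moreover $l=4k$ and $\xi$ is oriented, let $(R^k)^{\pm}_{+}$ and $(R^k)^{\pm}_{-}$ be the components of $R^k$ in $\Lambda^{2k}_{\pm}T^*M\otimes\Lambda^{2k}_{+}\xi^*$ and $\Lambda^{2k}_{\pm}T^*M\otimes\Lambda^{2k}_{-}\xi^*$. Then $$p_k(\xi)=\frac{1}{(2\pi)^{2k}(k!)^2}\left(|(R^k)^+_+|^2+|(R^k)^+_-|^2-|(R^k)^-_+|^2-|(R^k)^-_-|^2\right)\epsilon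 .$$ -/

import Mathlib

open Module Bundle
open scoped Manifold ContDiff TensorProduct Topology

noncomputable section

namespace PontryaginForm

/-! ### Exterior algebra of an inner product space -/

section Algebra

variable {V W : Type*} [NormedAddCommGroup V] [InnerProductSpace ℝ V] [FiniteDimensional ℝ V]
  [NormedAddCommGroup W] [InnerProductSpace ℝ W] [FiniteDimensional ℝ W]

/-- The inner product on the dual space `V*` that makes the Riesz isomorphism `V ≃ V*` an
isometry; its norm is the usual dual norm. -/
instance dualInnerProductSpace : InnerProductSpace ℝ (StrongDual ℝ V) where
  inner f g := inner ℝ ((InnerProductSpace.toDual ℝ V).symm f)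
    ((InnerProductSpace.toDual ℝ V).symm g)
  norm_sq_eq_re_inner f := by
    have h := norm_sq_eq_re_inner (𝕜 := ℝ) ((InnerProductSpace.toDual ℝ V).symm f)
    rwa [LinearIsometryEquiv.norm_map] at h
  conj_inner_symm f g := real_inner_comm _ _
  add_left f g h := by simp [inner_add_left]
  smul_left f g r := by simp [inner_smul_left]

/-- The forms `Λ^p V*`, with the inner product for which the `e^{i₁} ∧ ⋯ ∧ e^{i_p}`,
`i₁ < ⋯ < i_p`, are orthonormal whenever `e` is an orthonormal basis. -/
abbrev Form (p : ℕ) (V : Type*) [NormedAddCommGroup V] [InnerProductSpace ℝ V] : Type _ :=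
  ⋀[ℝ]^p (StrongDual ℝ V)

/-- The dual of a finite-dimensional space is finite-dimensional. -/
instance dual_finiteDimensional : FiniteDimensional ℝ (StrongDual ℝ V) :=
  (InnerProductSpace.toDual ℝ V).toLinearEquiv.finiteDimensional

/-- Shortcut to the norm on `Λ^p V*` that Mathlib defines. -/
instance formNormedAddCommGroup (p : ℕ) : NormedAddCommGroup (Form p V) :=
  exteriorPower.instNormedAddCommGroupSubtypeExteriorAlgebraRealMemSubmoduleExteriorPowerOfFiniteDimensional

/-- Shortcut to the inner product on `Λ^p V*` that Mathlib defines. -/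
instance formInnerProductSpace (p : ℕ) : InnerProductSpace ℝ (Form p V) :=
  exteriorPower.instInnerProductSpaceRealSubtypeExteriorAlgebraMemSubmoduleExteriorPower

/-- The `(p, q)`-bi-forms `Λ^p V* ⊗ Λ^q W*`, with the tensor product inner product. -/
abbrev BiForm (p q : ℕ) (V W : Type*) [NormedAddCommGroup V] [InnerProductSpace ℝ V]
    [NormedAddCommGroup W] [InnerProductSpace ℝ W] : Type _ :=
  Form p V ⊗[ℝ] Form q W

/-- The wedge product of forms, `Λ^p V* × Λ^q V* → Λ^{p+q} V*`. -/
def wedge (p q : ℕ) : Form p V →ₗ[ℝ] Form q V →ₗ[ℝ] Form (p + q) V :=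
  LinearMap.mk₂ ℝ (fun α β => ⟨(α : ExteriorAlgebra ℝ (StrongDual ℝ V)) * β,
      SetLike.mul_mem_graded α.2 β.2⟩)
    (fun _ _ _ => Subtype.ext (add_mul _ _ _))
    (fun _ _ _ => Subtype.ext (smul_mul_assoc _ _ _))
    (fun _ _ _ => Subtype.ext (mul_add _ _ _))
    (fun _ _ _ => Subtype.ext (mul_smul_comm _ _ _))

/-- The wedge product of bi-forms,
`(φ₁ ⊗ ψ₁) ∧ (φ₂ ⊗ ψ₂) = (φ₁ ∧ φ₂) ⊗ (ψ₁ ∧ ψ₂)`. -/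
def biWedge (p q p' q' : ℕ) :
    BiForm p q V W →ₗ[ℝ] BiForm p' q' V W →ₗ[ℝ] BiForm (p + p') (q + q') V W :=
  TensorProduct.map₂ (wedge p p') (wedge q q')

/-- The power `R^k = R ∧ ⋯ ∧ R` of a `(2, 2)`-bi-form, a `(2k, 2k)`-bi-form. -/
def biPow (R : BiForm 2 2 V W) : (k : ℕ) → BiForm (2 * k) (2 * k) V W
  | 0 => exteriorPower.ιMulti ℝ 0 ![] ⊗ₜ[ℝ] exteriorPower.ιMulti ℝ 0 ![]
  | k + 1 => biWedge (2 * k) (2 * k) 2 2 (biPow R k) R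

/-- The volume element `ε = e^1 ∧ ⋯ ∧ e^n` of an oriented inner product space, where `e` is any
oriented orthonormal basis. It is computed from an arbitrary orthonormal basis `b` as
`ω(b₁, …, b_n) b^1 ∧ ⋯ ∧ b^n`, with `ω(b₁, …, b_n) = ±1` the sign of `b`. -/
def volumeElement {n : ℕ} (hn : finrank ℝ V = n) (o : Orientation ℝ V (Fin n)) :
    ExteriorAlgebra ℝ (StrongDual ℝ V) :=
  haveI : Fact (finrank ℝ V = n) := ⟨hn⟩
  letI b : OrthonormalBasis (Fin n) ℝ V := (stdOrthonormalBasis ℝ V).reindex (finCongr hn)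
  o.volumeForm b • ExteriorAlgebra.ιMulti ℝ n fun i => InnerProductSpace.toDual ℝ V (b i)

/-- `IsHodgeStar ε β γ` says that `γ = *β`, i.e. `α ∧ γ = (α, β) ε` for all `p`-forms `α`,
where `ε` is the volume element. -/
def IsHodgeStar (ε : ExteriorAlgebra ℝ (StrongDual ℝ V)) {p q : ℕ}
    (β : Form p V) (γ : Form q V) : Prop :=
  ∀ α : Form p V, (α : ExteriorAlgebra ℝ (StrongDual ℝ V)) * γ = (inner ℝ α β : ℝ) • ε

/-- The forms `β` with `*β = c β`; self-dual forms for `c = 1`, anti-self-dual for `c = -1`. -/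
def dualityEigenspace (ε : ExteriorAlgebra ℝ (StrongDual ℝ V)) (p : ℕ) (c : ℝ) :
    Submodule ℝ (Form p V) where
  carrier := {β | IsHodgeStar ε β (c • β)}
  zero_mem' α := by simp
  add_mem' {β γ} hβ hγ α := by
    rw [smul_add, Submodule.coe_add, mul_add, hβ α, hγ α, inner_add_right, add_smul]
  smul_mem' r β hβ α := by
    rw [smul_comm, Submodule.coe_smul, mul_smul_comm, hβ α, inner_smul_right, mul_smul]

/-- The self-dual forms. -/
abbrev selfDual (ε : ExteriorAlgebra ℝ (StrongDual ℝ V)) (p : ℕ) : Submodule ℝ (Form p V) :=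
  dualityEigenspace ε p 1

/-- The anti-self-dual forms. -/
abbrev antiSelfDual (ε : ExteriorAlgebra ℝ (StrongDual ℝ V)) (p : ℕ) : Submodule ℝ (Form p V) :=
  dualityEigenspace ε p (-1)

/-- The component of a bi-form in `A ⊗ Λ^q W*`, for a subspace `A` of `Λ^p V*`. -/
def leftPart {p q : ℕ} (A : Submodule ℝ (Form p V)) (T : BiForm p q V W) : BiForm p q V W :=
  TensorProduct.map (A.starProjection : Form p V →ₗ[ℝ] Form p V) LinearMap.id T

/-- The component of a bi-form in `A ⊗ B`, for subspaces `A` of `Λ^p V*` and `B` of `Λ^q W*`. -/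
def bothParts {p q : ℕ} (A : Submodule ℝ (Form p V)) (B : Submodule ℝ (Form q W))
    (T : BiForm p q V W) : BiForm p q V W :=
  TensorProduct.map (A.starProjection : Form p V →ₗ[ℝ] Form p V)
    (B.starProjection : Form q W →ₗ[ℝ] Form q W) T

variable (V) in
/-- The elementary `2`-form `e^i ∧ e^j` of a fixed orthonormal basis `e` of `V`. -/
def elemForm (i j : Fin (finrank ℝ V)) : Form 2 V :=
  exteriorPower.ιMulti ℝ 2 ![InnerProductSpace.toDual ℝ V (stdOrthonormalBasis ℝ V i),
    InnerProductSpace.toDual ℝ V (stdOrthonormalBasis ℝ V j)]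

/-- The element `∑_{i<j} B(e_i, e_j) e^i ∧ e^j` of `Λ² V*` given by a skew bilinear form `B`. -/
def toForm (B : V → V → ℝ) : Form 2 V :=
  (1 / 2 : ℝ) • ∑ i, ∑ j, B (stdOrthonormalBasis ℝ V i) (stdOrthonormalBasis ℝ V j) •
    elemForm V i j

/-- The element `∑_{i<j} ∑_{a<b} T(e_i, e_j, s_a, s_b) (e^i ∧ e^j) ⊗ (s^a ∧ s^b)` of
`Λ² V* ⊗ Λ² W*` given by a multilinear form `T` that is skew in the first two and in the last
two arguments. -/
def toBiForm (T : V → V → W → W → ℝ) : BiForm 2 2 V W :=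
  (1 / 4 : ℝ) • ∑ i, ∑ j, ∑ a, ∑ b,
    T (stdOrthonormalBasis ℝ V i) (stdOrthonormalBasis ℝ V j)
      (stdOrthonormalBasis ℝ W a) (stdOrthonormalBasis ℝ W b) •
    (elemForm V i j ⊗ₜ[ℝ] elemForm W a b)

end Algebra

/-! ### Orientations of vector bundles -/

/-- An orientation of a vector bundle of rank `n`: an orientation of each fibre, locally constant
in the local trivializations. -/
structure BundleOrientation (n : ℕ) {M : Type*} [TopologicalSpace M]
    (F : Type*) [NormedAddCommGroup F] [NormedSpace ℝ F] (V : M → Type*)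
    [TopologicalSpace (TotalSpace F V)] [∀ x, AddCommGroup (V x)] [∀ x, Module ℝ (V x)]
    [∀ x, TopologicalSpace (V x)] [FiberBundle F V] [VectorBundle ℝ F V] where
  /-- The orientation of the fibre at `x`. -/
  fibre : ∀ x, Orientation ℝ (V x) (Fin n)
  locally_constant : ∀ x₀, ∀ᶠ x in 𝓝 x₀, ∀ hx : x ∈ (trivializationAt F V x₀).baseSet,
    Orientation.map (Fin n)
        ((trivializationAt F V x₀).continuousLinearEquivAt ℝ x hx).toLinearEquiv (fibre x) =
      Orientation.map (Fin n)
        ((trivializationAt F V x₀).continuousLinearEquivAt ℝ x₀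
          (FiberBundle.mem_baseSet_trivializationAt F V x₀)).toLinearEquiv (fibre x₀)

/-! ### Curvature -/

section Curvature

variable {E : Type*} [NormedAddCommGroup E] [NormedSpace ℝ E]
  {H : Type*} [TopologicalSpace H] {I : ModelWithCorners ℝ E H}
  {M : Type*} [TopologicalSpace M] [ChartedSpace H M]
  {F : Type*} [NormedAddCommGroup F] [NormedSpace ℝ F]
  {V : M → Type*} [TopologicalSpace (TotalSpace F V)]
  [∀ x, NormedAddCommGroup (V x)] [∀ x, InnerProductSpace ℝ (V x)] [FiberBundle F V]

/-- The curvature `R(X, Y)s = D_X D_Y s - D_Y D_X s - D_{[X, Y]} s` of a connection `D`, on vector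
fields `X`, `Y` and a section `s`. (Mathlib writes `D s x (X x)` for `(D_X s)(x)`.) -/
def curvature (D : CovariantDerivative I F V) (X Y : Π x : M, TangentSpace I x)
    (s : Π x : M, V x) (x : M) : V x :=
  D (fun y => D s y (Y y)) x (X x) - D (fun y => D s y (X y)) x (Y x) -
    D s x (VectorField.mlieBracket I X Y x)

variable [IsManifold I 1 M]

/-- The curvature at a point, `R(X₀, Y₀)s₀ ∈ ξ_x` for `X₀, Y₀ ∈ T_xM` and `s₀ ∈ ξ_x`. The curvature
being tensorial, it may be computed on any local extensions of `X₀`, `Y₀`, `s₀` that are smooth near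
`x`; `FiberBundle.extend` is constant in a local trivialization around `x`. -/
def curvatureAt (D : CovariantDerivative I F V) (x : M) (X₀ Y₀ : TangentSpace I x) (s₀ : V x) :
    V x :=
  curvature D (FiberBundle.extend E X₀) (FiberBundle.extend E Y₀) (FiberBundle.extend F s₀) x

/-- Tangent spaces of a finite-dimensional manifold are finite-dimensional. -/
instance tangentSpace_finiteDimensional [FiniteDimensional ℝ E] (x : M) :
    FiniteDimensional ℝ (TangentSpace I x) :=
  inferInstanceAs (FiniteDimensional ℝ E)

variable [FiniteDimensional ℝ E] [RiemannianBundle (fun x : M => TangentSpace I x)]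

/-- The curvature matrix of `2`-forms in a basis `s` of the fibre `ξ_x`:
`R^a_b(X, Y) = s^a(R(X, Y) s_b)`. -/
def curvatureMatrix (D : CovariantDerivative I F V) (x : M) {l : ℕ} (s : Basis (Fin l) ℝ (V x))
    (a b : Fin l) : Form 2 (TangentSpace I x) :=
  toForm fun X Y => s.coord a (curvatureAt D x X Y (s b))

/-- The Chern–Weil form of the `k`-th Pontryagin class at `x`, written in a basis `s` of the fibre:
`(2π)^{-2k} ∑_{a₁ < ⋯ < a_{2k}} ∑_σ sgn(σ) R^{a₁}_{a_{σ(1)}} ∧ ⋯ ∧ R^{a_{2k}}_{a_{σ(2k)}}`. -/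
def pontryaginForm (D : CovariantDerivative I F V) (k : ℕ) (x : M) {l : ℕ}
    (s : Basis (Fin l) ℝ (V x)) : ExteriorAlgebra ℝ (StrongDual ℝ (TangentSpace I x)) :=
  (1 / (2 * Real.pi) ^ (2 * k) : ℝ) •
    ∑ a : Fin (2 * k) ↪o Fin l, ∑ σ : Equiv.Perm (Fin (2 * k)),
      (Equiv.Perm.sign σ : ℤ) •
        (List.ofFn fun i => (curvatureMatrix D x s (a i) (a (σ i)) :
          ExteriorAlgebra ℝ (StrongDual ℝ (TangentSpace I x)))).prod

/-- The curvature at `x` as a `(2, 2)`-bi-form, `R(X, Y, s, t) = h(R(X, Y) t, s)`. -/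
def curvatureBiForm (D : CovariantDerivative I F V) (x : M) [FiniteDimensional ℝ (V x)] :
    BiForm 2 2 (TangentSpace I x) (V x) :=
  toBiForm fun X Y s t => inner ℝ (curvatureAt D x X Y t) s

/-- The power `R^k` of the curvature bi-form at `x`. -/
abbrev curvaturePow (D : CovariantDerivative I F V) (k : ℕ) (x : M) [FiniteDimensional ℝ (V x)] :
    BiForm (2 * k) (2 * k) (TangentSpace I x) (V x) :=
  biPow (curvatureBiForm D x) k

end Curvature

/-- The volume element of an oriented Riemannian vector bundle of rank `n`, at the point `x`. -/
def BundleOrientation.vol {n : ℕ} {M : Type*} [TopologicalSpace M]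
    {F : Type*} [NormedAddCommGroup F] [NormedSpace ℝ F] {V : M → Type*}
    [TopologicalSpace (TotalSpace F V)] [∀ x, NormedAddCommGroup (V x)]
    [∀ x, InnerProductSpace ℝ (V x)] [FiberBundle F V] [VectorBundle ℝ F V]
    [∀ x, FiniteDimensional ℝ (V x)] (o : BundleOrientation n F V) (hF : finrank ℝ F = n) (x : M) :
    ExteriorAlgebra ℝ (StrongDual ℝ (V x)) :=
  volumeElement ((VectorBundle.finrank_eq ℝ F V x).trans hF) (o.fibre x)

end PontryaginForm

end

/-! Everything happens in one fibre. In an orthonormal basis `w` of the fibre, the curvature is a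
matrix `A` of 2-forms `A c d = (R w_d, w_c)`. Its entries commute, so determinants and Pfaffians of
`A` make sense, and `A` is skew because the connection is metric (`inner_curvatureAt`).

Up to the power of 2π, the Chern–Weil form is the sum of the principal 2k-minors of the curvature
matrix. This sum is invariant under change of frame (`minorSum_mul_comm`), so it may be computed
from `A`, where each minor is the square of a Pfaffian (`pfSum_sq`).

On the other side, the coefficient of `R^k` at an increasing multi-index of the fibre is `k!` times
the corresponding Pfaffian. In the middle degree, which is even, the Hodge star is a symmetric
involution `S` with `α ∧ β = (α, S β) ε` (`exists_hodgeStar`). Hence `(|T⁺|² - |T⁻|²) ε = (T, (S ⊗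
1) T) ε` is the contraction of `T` with itself, wedging the form factors and pairing the fibre
factors (`norm_sq_selfDual_sub`). For `T = R^k` this is `(k!)²` times the sum of the squared
Pfaffians; `sum_inner_ιMulti_smul` and `pairProd_sum` do the counting, with sums over all index
tuples in place of increasing ones.

The refined formula follows by Pythagoras in the fibre factor (`norm_sq_bothParts_add`). -/

noncomputable section

namespace PontryaginForm

/-! ### Pfaffians -/

section Pfaffian

variable {C : Type*} [CommRing C]

/-- The product `∏ i, A (f (2i)) (f (2i+1))` over the consecutive pairs of `f`. -/
def pairProd {ι : Type*} (A : ι → ι → C) (k : ℕ) (f : Fin (2 * k) → ι) : C :=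
  ∏ i : Fin k, A (f ⟨2 * i, by omega⟩) (f ⟨2 * i + 1, by omega⟩)

/-- `2^k k!` times the Pfaffian of `A`. -/
def pfSum (k : ℕ) (A : Fin (2 * k) → Fin (2 * k) → C) : C :=
  ∑ σ : Equiv.Perm (Fin (2 * k)), (Equiv.Perm.sign σ : ℤ) • pairProd A k σ

theorem pairProd_succ {ι : Type*} (A : ι → ι → C) (k : ℕ) (f : Fin (2 * k) → ι) (g : Fin 2 → ι) :
    pairProd A (k + 1) (Fin.append f g : Fin (2 * k + 2) → ι) = pairProd A k f * A (g 0) (g 1) := by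
  have h0 : (⟨2 * k, by omega⟩ : Fin (2 * k + 2)) = Fin.natAdd (2 * k) 0 := rfl
  have h1 : (⟨2 * k + 1, by omega⟩ : Fin (2 * k + 2)) = Fin.natAdd (2 * k) 1 := rfl
  rw [pairProd, Fin.prod_univ_castSucc, pairProd]
  congr 1
  · refine Finset.prod_congr rfl fun i _ => ?_
    have e0 : (⟨2 * (i : ℕ), by omega⟩ : Fin (2 * k + 2)) =
        Fin.castAdd 2 ⟨2 * (i : ℕ), by omega⟩ := rfl
    have e1 : (⟨2 * (i : ℕ) + 1, by omega⟩ : Fin (2 * k + 2)) =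
        Fin.castAdd 2 ⟨2 * (i : ℕ) + 1, by omega⟩ := rfl
    simp only [Fin.val_castSucc]
    erw [e0, e1, Fin.append_left, Fin.append_left]
  · simp only [Fin.val_last]
    erw [h0, h1, Fin.append_right, Fin.append_right]

/-- Sums over maps out of `Fin (m + n)` split into sums over the two parts. -/
theorem sum_append {ι N : Type*} [Fintype ι] [AddCommMonoid N] (m n : ℕ)
    (F : (Fin (m + n) → ι) → N) :
    ∑ f, F f = ∑ f : Fin m → ι, ∑ g : Fin n → ι, F (Fin.append f g) := by
  rw [← Fintype.sum_prod_type', ← (Fin.appendEquiv m n).sum_comp]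
  rfl

theorem sum_finTwo {ι N : Type*} [Fintype ι] [AddCommMonoid N] (F : (Fin 2 → ι) → N) :
    ∑ g, F g = ∑ a, ∑ b, F ![a, b] := by
  rw [← Fintype.sum_prod_type', ← (finTwoArrowEquiv ι).symm.sum_comp]
  rfl

/-- In a sum against an alternating map only the permutations contribute. -/
theorem sum_alternatingMap {M N ι : Type*} [AddCommGroup M] [Module C M] [AddCommGroup N]
    [Module C N] [Fintype ι] [DecidableEq ι] (g : M [⋀^ι]→ₗ[C] N) (v : ι → M) (c : (ι → ι) → C) :
    ∑ f : ι → ι, c f • g (v ∘ f) =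
      (∑ σ : Equiv.Perm ι, (Equiv.Perm.sign σ : ℤ) • c σ) • g v := by
  rw [Finset.sum_smul]
  symm
  refine Finset.sum_of_injOn (fun σ : Equiv.Perm ι => (σ : ι → ι))
    (fun σ _ τ _ h => Equiv.coe_fn_injective h) (by simp) ?_ ?_
  · intro f _ hf
    rw [AlternatingMap.map_eq_zero_of_not_injective, smul_zero]
    intro hinj
    exact hf ⟨Equiv.ofBijective f (Finite.injective_iff_bijective.1 (hinj.of_comp)), by simp, rfl⟩
  · intro σ _
    rw [AlternatingMap.map_perm, smul_assoc, smul_comm]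
    rfl

/-- A permutation changes both factors by the same sign, so all permutations contribute equally;
non-injective maps contribute nothing. -/
theorem sum_alternatingMap_mul {M N J : Type*} [AddCommGroup M] [Module C M] [Ring N]
    [Algebra C N] [Fintype J] [DecidableEq J] (g h : M [⋀^J]→ₗ[C] N) (u w : J → M) :
    ∑ f : J → J, g (u ∘ f) * h (w ∘ f) = (Fintype.card J).factorial • (g u * h w) := by
  rw [← Fintype.card_perm, ← Finset.card_univ, ← Finset.sum_const]
  symm
  refine Finset.sum_of_injOn (fun σ : Equiv.Perm J => (σ : J → J))
    (fun σ _ τ _ h => Equiv.coe_fn_injective h) (by simp) ?_ ?_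
  · intro f _ hf
    rw [AlternatingMap.map_eq_zero_of_not_injective, zero_mul]
    intro hinj
    exact hf ⟨Equiv.ofBijective f (Finite.injective_iff_bijective.1 (hinj.of_comp)), by simp, rfl⟩
  · intro σ _
    rw [AlternatingMap.map_perm, AlternatingMap.map_perm]
    rcases Int.units_eq_one_or (Equiv.Perm.sign σ) with h | h <;> simp [h]

theorem alternatingMap_mulVec {M N ι : Type*} [AddCommGroup M] [Module C M] [AddCommGroup N]
    [Module C N] [Fintype ι] [DecidableEq ι] (g : M [⋀^ι]→ₗ[C] N) (v : ι → M) (A : Matrix ι ι C) :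
    g (fun a => ∑ b, A a b • v b) = A.det • g v := by
  have h : g (fun a => ∑ b, A a b • v b) = ∑ f : ι → ι, (∏ a, A a (f a)) • g (v ∘ f) := by
    rw [← AlternatingMap.coe_multilinearMap, MultilinearMap.map_sum]
    refine Finset.sum_congr rfl fun f _ => ?_
    rw [MultilinearMap.map_smul_univ]
    rfl
  rw [h, sum_alternatingMap, ← Matrix.det_transpose, Matrix.det_apply]
  rfl

/-! ### Powers of quadratic elements in an exterior algebra -/

section Exterior

open ExteriorAlgebra

variable {M : Type*} [AddCommGroup M] [Module C M]

theorem append_comp {J N : Type*} {m n : ℕ} (z : J → N) (f : Fin m → J) (g : Fin n → J) :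
    z ∘ Fin.append f g = Fin.append (z ∘ f) (z ∘ g) := by
  ext i
  refine Fin.addCases (fun i => ?_) (fun i => ?_) i <;> simp

theorem ιMulti_one (x : M) : ιMulti C 1 ![x] = ι C x := by simp [ιMulti_apply]

theorem ιMulti_two (x y : M) : ιMulti C 2 ![x, y] = ι C x * ι C y := by simp [ιMulti_apply]

/-- When `J` has 2k elements, collecting the permutations on the right yields the Pfaffian as the
coefficient of the top monomial. -/
theorem quadratic_pow {J : Type*} [Fintype J] (A : J → J → C) (v : J → M) (k : ℕ) :
    (∑ a, ∑ b, A a b • (ι C (v a) * ι C (v b))) ^ k =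
      ∑ f : Fin (2 * k) → J, pairProd A k f • ιMulti C (2 * k) (v ∘ f) := by
  induction k with
  | zero => simp [pairProd]
  | succ k ih =>
    rw [pow_succ, ih]
    refine Eq.trans ?_ (sum_append (2 * k) 2 _).symm
    rw [Finset.sum_mul]
    refine Finset.sum_congr rfl fun f _ => ?_
    rw [sum_finTwo, Finset.mul_sum]
    refine Finset.sum_congr rfl fun a _ => ?_
    rw [Finset.mul_sum]
    refine Finset.sum_congr rfl fun b _ => ?_
    have h : v ∘ (Fin.append f ![a, b]) = Fin.append (v ∘ f) ![v a, v b] := by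
      rw [append_comp]; congr 1; ext i; fin_cases i <;> rfl
    erw [pairProd_succ, h, ← ιMulti_mul_ιMulti, ιMulti_two]
    rw [smul_mul_smul_comm]
    rfl

/-- Products of two vectors are central. -/
theorem commute_ι_mul_ι (x y : M) (z : ExteriorAlgebra C M) : Commute (ι C x * ι C y) z := by
  have swap (a b : M) : ι C a * ι C b = -(ι C b * ι C a) :=
    eq_neg_of_add_eq_zero_left (ι_add_mul_swap a b)
  induction z using ExteriorAlgebra.induction with
  | algebraMap r => exact (Algebra.commutes r _).symm
  | ι m =>
    rw [Commute, SemiconjBy, mul_assoc, swap y m, mul_neg, ← mul_assoc, swap x m, neg_mul, neg_neg,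
      mul_assoc]
  | mul a b ha hb => exact ha.mul_right hb
  | add a b ha hb => exact ha.add_right hb

theorem ι_mul_ιMulti (m : ℕ) (u : Fin m → M) (x : M) :
    ιMulti C m u * ι C x = (-1 : C) ^ m • (ι C x * ιMulti C m u) := by
  induction m with
  | zero => simp
  | succ m ih =>
    rw [ιMulti_succ_apply, mul_assoc, ih, mul_smul_comm, ← mul_assoc, ← mul_assoc,
      eq_neg_of_add_eq_zero_left (ι_add_mul_swap (u 0) x), pow_succ]
    simp

/-- The sign `(-1)^{m(m-1)/2}` of reversing the order of `m` objects. -/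
def reversalSign (C : Type*) [CommRing C] (m : ℕ) : C := ∏ i ∈ Finset.range m, (-1) ^ i

theorem reversalSign_two_mul (k : ℕ) : reversalSign C (2 * k) = (-1) ^ k := by
  induction k with
  | zero => simp [reversalSign]
  | succ k ih =>
    rw [show 2 * (k + 1) = 2 * k + 1 + 1 by ring, reversalSign, Finset.prod_range_succ,
      Finset.prod_range_succ, ← reversalSign, ih]
    simp [pow_succ, pow_mul]

/-- Sorting `u w u w ⋯` into `u ⋯ u w ⋯ w` moves each `u` past all earlier `w`'s, which costs 0 + 1
+ ⋯ + (m - 1) transpositions. -/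
theorem sum_mul_pow {J : Type*} [Fintype J] (u w : J → M) (m : ℕ) :
    (∑ a, ι C (u a) * ι C (w a)) ^ m =
      reversalSign C m • ∑ f : Fin m → J, ιMulti C m (u ∘ f) * ιMulti C m (w ∘ f) := by
  induction m with
  | zero => simp [reversalSign]
  | succ m ih =>
    rw [pow_succ, ih, sum_append m 1, smul_mul_assoc, Finset.sum_mul,
      show reversalSign C (m + 1) = reversalSign C m * (-1) ^ m from Finset.prod_range_succ _ _,
      mul_smul, Finset.smul_sum (r := (-1 : C) ^ m)]
    congr 1
    refine Finset.sum_congr rfl fun f _ => ?_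
    rw [← (Equiv.funUnique (Fin 1) J).symm.sum_comp, Finset.mul_sum, Finset.smul_sum]
    refine Finset.sum_congr rfl fun a _ => ?_
    have h (z : J → M) : z ∘ Fin.append f ((Equiv.funUnique (Fin 1) J).symm a) =
        Fin.append (z ∘ f) ![z a] := by
      rw [append_comp]; congr 1; ext i; fin_cases i; rfl
    rw [h, h, ← ιMulti_mul_ιMulti, ← ιMulti_mul_ιMulti, ιMulti_one, ιMulti_one, mul_assoc,
      ← mul_assoc _ (ι C (u a)), ι_mul_ιMulti]
    simp [mul_assoc]

end Exterior

/-- The coefficient of the top degree monomial. -/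
def topCoeff (C : Type*) [CommRing C] (n : ℕ) :
    ExteriorAlgebra C (Fin n ⊕ Fin n → C) →ₗ[C] C :=
  ExteriorAlgebra.liftAlternating
    (Pi.single (n + n) (Matrix.detRowAlternating.domDomCongr finSumFinEquiv))

theorem topCoeff_mul {n : ℕ} (u w : Fin n → Fin n ⊕ Fin n → C) :
    topCoeff C n (ExteriorAlgebra.ιMulti C n u * ExteriorAlgebra.ιMulti C n w) =
      Matrix.det (Matrix.of (Sum.elim u w)) := by
  rw [ExteriorAlgebra.ιMulti_mul_ιMulti, topCoeff, ExteriorAlgebra.liftAlternating_apply_ιMulti,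
    Pi.single_eq_same, AlternatingMap.domDomCongr_apply]
  congr 1
  ext i j
  rcases i with i | i
  · simp
  · exact congrFun (Fin.append_right u w i) j

open ExteriorAlgebra in
/-- The determinant of a skew-symmetric matrix is the square of its Pfaffian. -/
theorem pfSum_sq [IsAddTorsionFree C] (k : ℕ) (A : Fin (2 * k) → Fin (2 * k) → C)
    (hA : ∀ a b, A a b = -A b a) :
    pfSum k A ^ 2 = ((2 ^ k * k.factorial) ^ 2 : ℕ) * (Matrix.of A).det := by
  classical
  -- Two independent copies `x`, `y` of the generators. The top coefficient of `(P - Q)^(2k)` is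
  -- computed twice: by the binomial theorem it gives the squared Pfaffian, by factoring `P - Q` it
  -- gives the determinant.
  set x : Fin (2 * k) → Fin (2 * k) ⊕ Fin (2 * k) → C := fun a => Pi.single (Sum.inl a) 1 with hx
  set y : Fin (2 * k) → Fin (2 * k) ⊕ Fin (2 * k) → C := fun a => Pi.single (Sum.inr a) 1 with hy
  have hpow (v : Fin (2 * k) → Fin (2 * k) ⊕ Fin (2 * k) → C) :
      (∑ a, ∑ b, A a b • (ι C (v a) * ι C (v b))) ^ k = pfSum k A • ιMulti C (2 * k) v := by
    rw [quadratic_pow, sum_alternatingMap]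
    rfl
  -- A product of 2k + 2 vectors chosen among 2k repeats one of them.
  have hzero (v : Fin (2 * k) → Fin (2 * k) ⊕ Fin (2 * k) → C) :
      (∑ a, ∑ b, A a b • (ι C (v a) * ι C (v b))) ^ (k + 1) = 0 := by
    rw [quadratic_pow]
    refine Finset.sum_eq_zero fun f _ => ?_
    rw [ιMulti_eq_zero_of_not_inj, smul_zero]
    intro h
    simpa using Fintype.card_le_of_injective f h.of_comp
  set P := ∑ a, ∑ b, A a b • (ι C (x a) * ι C (x b)) with hP
  set Q := ∑ a, ∑ b, A a b • (ι C (y a) * ι C (y b)) with hQ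
  have hPQ : Commute P Q :=
    Commute.sum_left _ _ _ fun a _ => Commute.sum_left _ _ _ fun b _ =>
      (commute_ι_mul_ι _ _ _).smul_left _
  have hcross : ∑ a, ∑ b, A a b • (ι C (y a) * ι C (x b)) =
      ∑ a, ∑ b, A a b • (ι C (x a) * ι C (y b)) := by
    rw [Finset.sum_comm]
    refine Finset.sum_congr rfl fun a _ => Finset.sum_congr rfl fun b _ => ?_
    rw [hA b a, eq_neg_of_add_eq_zero_left (ι_add_mul_swap (y b) (x a)), neg_smul, smul_neg,
      neg_neg]
  -- A difference of two squares: the mixed terms cancel by `hcross`, which is where skewness of `A`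
  -- enters.
  have hS : P + -Q = ∑ a, ι C (x a + y a) * ι C (∑ b, A a b • (x b - y b)) := by
    simp only [map_add, map_sum, map_smul, map_sub, Finset.mul_sum, add_mul, mul_smul_comm, mul_sub,
      smul_add, smul_sub, Finset.sum_add_distrib, Finset.sum_sub_distrib]
    rw [hcross]
    abel
  have hxy : topCoeff C (2 * k) (ιMulti C (2 * k) x * ιMulti C (2 * k) y) = 1 := by
    rw [topCoeff_mul, show Matrix.of (Sum.elim x y) = 1 from ?_, Matrix.det_one]
    ext i j
    rcases i with i | i <;> rcases j with j | j <;>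
      simp [x, y, Matrix.one_apply, Pi.single_apply, eq_comm]
  -- The change of generators to `x + y`, `x - y` has block determinant `(-2)^(2k)`.
  have hθ : topCoeff C (2 * k) (ιMulti C (2 * k) (fun a => x a + y a) *
      ιMulti C (2 * k) (fun a => x a - y a)) = 2 ^ (2 * k) := by
    rw [topCoeff_mul, show Matrix.of (Sum.elim (fun a => x a + y a) fun a => x a - y a) =
      Matrix.fromBlocks 1 1 1 (-1) from ?_, Matrix.det_fromBlocks_one₁₁]
    · rw [mul_one, show (-1 - 1 : Matrix (Fin (2 * k)) (Fin (2 * k)) C) = (-2 : C) • 1 from ?_,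
        Matrix.det_smul]
      · simp [pow_mul]
      · ext i j
        by_cases h : i = j <;> simp [h]; norm_num
    · ext i j
      rcases i with i | i <;> rcases j with j | j <;>
        simp [x, y, Matrix.one_apply, Pi.single_apply, eq_comm]
  -- Only the middle binomial term survives, since `P^(k+1)` and `Q^(k+1)` vanish.
  have h1 : topCoeff C (2 * k) ((P + -Q) ^ (2 * k)) =
      (-1) ^ k * ((2 * k).choose k * pfSum k A ^ 2) := by
    rw [hPQ.neg_right.add_pow, Finset.sum_eq_single k]
    · rw [show 2 * k - k = k by omega, neg_pow, hpow, hpow]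
      rw [← Nat.cast_comm, ← nsmul_eq_mul, map_nsmul, smul_mul_assoc, mul_smul_comm]
      rw [show (-1 : ExteriorAlgebra C (Fin (2 * k) ⊕ Fin (2 * k) → C)) ^ k =
        algebraMap C _ ((-1) ^ k) by simp, Algebra.mul_smul_comm, ← Algebra.smul_def]
      simp only [mul_smul_comm, map_smul, hxy, smul_eq_mul, nsmul_eq_mul]
      ring
    · intro m hm hmk
      rcases lt_or_gt_of_ne hmk with h | h
      · obtain ⟨d, hd⟩ : ∃ d, 2 * k - m = (k + 1) + d := ⟨2 * k - m - (k + 1), by omega⟩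
        rw [hd, neg_pow, pow_add Q, hzero]
        simp
      · obtain ⟨d, hd⟩ : ∃ d, m = (k + 1) + d := ⟨m - (k + 1), by omega⟩
        rw [hd, pow_add P, hzero]
        simp
    · intro h
      exact absurd (Finset.mem_range.2 (by omega)) h
  have h2 : topCoeff C (2 * k) ((P + -Q) ^ (2 * k)) =
      (-1) ^ k * ((2 * k).factorial * 2 ^ (2 * k) * (Matrix.of A).det) := by
    have hdet : ιMulti C (2 * k) (fun a => ∑ b, A a b • (x b - y b)) =
        (Matrix.of A).det • ιMulti C (2 * k) (fun b => x b - y b) := alternatingMap_mulVec _ _ _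
    rw [hS, sum_mul_pow, reversalSign_two_mul, map_smul, smul_eq_mul]
    congr 1
    rw [sum_alternatingMap_mul, hdet, mul_smul_comm, map_nsmul, map_smul, hθ, Fintype.card_fin]
    simp only [smul_eq_mul, nsmul_eq_mul]
    ring
  have h3 : (-1 : C) ^ k * (-1) ^ k = 1 := by rw [← mul_pow]; simp
  have h4 : ((2 * k).choose k : C) * pfSum k A ^ 2 =
      (2 * k).factorial * 2 ^ (2 * k) * (Matrix.of A).det := by
    have := h1.symm.trans h2
    calc _ = (-1) ^ k * ((-1) ^ k * (((2 * k).choose k : C) * pfSum k A ^ 2)) := by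
          rw [← mul_assoc, h3, one_mul]
      _ = _ := by rw [this, ← mul_assoc, h3, one_mul]
  have h5 : (2 * k).factorial = (2 * k).choose k * (k.factorial * k.factorial) := by
    have := Nat.choose_mul_factorial_mul_factorial (show k ≤ 2 * k by omega)
    rw [show 2 * k - k = k by omega] at this
    rw [← this, mul_assoc]
  -- Torsion-freeness allows the binomial coefficient to be cancelled, as `(2k)! = choose (2k) k *
  -- k!²`.
  refine nsmul_right_injective (M := C) (Nat.choose_pos (show k ≤ 2 * k by omega)).ne' ?_
  simp only [nsmul_eq_mul]
  rw [h4, h5]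
  push_cast
  ring

end Pfaffian

/-! ### Sums of principal minors -/

section Minors

variable {C : Type*} [CommRing C]

/-- The sum of the principal minors of size `m`, over all ordered `m`-tuples of indices. -/
def minorSum {J : Type*} [Fintype J] (m : ℕ) (A : Matrix J J C) : C :=
  ∑ f : Fin m → J, (A.submatrix f f).det

theorem minorSum_eq {J : Type*} [Fintype J] (m : ℕ) (A : Matrix J J C) :
    minorSum m A = ∑ σ : Equiv.Perm (Fin m), (Equiv.Perm.sign σ : ℤ) •
      ∑ f : Fin m → J, ∏ i, A (f i) (f (σ i)) := by
  simp only [Finset.smul_sum]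
  rw [Finset.sum_comm]
  refine Finset.sum_congr rfl fun f _ => ?_
  rw [← Matrix.det_transpose, Matrix.det_apply]
  rfl

/-- The analogue of cyclicity of the trace. Summing over all tuples, not only increasing ones,
reduces it to a reindexing for each fixed permutation. -/
theorem minorSum_mul_comm {J K : Type*} [Fintype J] [Fintype K] (m : ℕ)
    (P : Matrix J K C) (N : Matrix K J C) : minorSum m (P * N) = minorSum m (N * P) := by
  rw [minorSum_eq, minorSum_eq]
  refine Finset.sum_congr rfl fun σ _ => congrArg _ ?_
  simp only [Matrix.mul_apply, Fintype.prod_sum, Finset.prod_mul_distrib]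
  rw [Finset.sum_comm]
  refine Finset.sum_congr rfl fun p _ => ?_
  -- Substitute `f ∘ σ⁻¹` for `f`, which moves `σ` from the entries of `N` to those of `P`.
  rw [← (σ.arrowCongr (Equiv.refl J)).sum_comp]
  refine Finset.sum_congr rfl fun f _ => ?_
  have h : ∀ i, (σ.arrowCongr (Equiv.refl J)) f (σ i) = f i := fun i => by simp
  rw [mul_comm]
  congr 1
  · simp only [h]
  · rw [← Equiv.prod_comp σ]
    simp only [h]

/-- A tuple with a repetition has a zero minor, and an injective tuple is uniquely an increasing one
composed with a permutation, which leaves the minor unchanged. -/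
theorem minorSum_eq_factorial_nsmul {l : ℕ} (m : ℕ) (A : Matrix (Fin l) (Fin l) C) :
    minorSum m A = m.factorial • ∑ a : Fin m ↪o Fin l, (A.submatrix a a).det := by
  have hperm (f : Fin m → Fin l) (σ : Equiv.Perm (Fin m)) :
      (A.submatrix (f ∘ σ) (f ∘ σ)).det = (A.submatrix f f).det := by
    rw [← Matrix.submatrix_submatrix, Matrix.det_submatrix_equiv_self]
  rw [Finset.smul_sum]
  have : ∀ a : Fin m ↪o Fin l, m.factorial • (A.submatrix a a).det =
      ∑ σ : Equiv.Perm (Fin m), (A.submatrix (a ∘ σ) (a ∘ σ)).det := by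
    intro a
    simp only [hperm, Finset.sum_const, Finset.card_univ, Fintype.card_perm, Fintype.card_fin]
  rw [Finset.sum_congr rfl fun a _ => this a, ← Fintype.sum_prod_type']
  symm
  refine Finset.sum_of_injOn
    (fun p : (Fin m ↪o Fin l) × Equiv.Perm (Fin m) => (p.1 ∘ p.2 : Fin m → Fin l)) ?_ (by simp) ?_
    (fun _ _ => rfl)
  · rintro ⟨a, σ⟩ - ⟨b, τ⟩ - h
    have hab : a = b := by
      rw [← OrderEmbedding.range_inj]
      have := congrArg Set.range h
      simpa [Set.range_comp] using this
    subst hab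
    have hστ : σ = τ := Equiv.ext fun i => a.injective (congrFun h i)
    rw [hστ]
  · intro f _ hf
    by_contra h0
    have hinj : Function.Injective f := by
      intro i j hij
      by_contra hne
      exact h0 (Matrix.det_zero_of_row_eq hne (by ext c; simp [hij]))
    have hmono : StrictMono (f ∘ Tuple.sort f) :=
      (Tuple.monotone_sort f).strictMono_of_injective (hinj.comp (Tuple.sort f).injective)
    refine hf ⟨⟨OrderEmbedding.ofStrictMono _ hmono, (Tuple.sort f)⁻¹⟩, by simp, ?_⟩
    ext i
    simp

/-- Since `pfSum` changes by the sign when the tuple is permuted, averaging over permutations turns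
the factor `pairProd` into a second `pfSum`; then `pfSum_sq` applies to each tuple. -/
theorem pairProd_sum {J : Type*} [Fintype J] [IsAddTorsionFree C] (k : ℕ) (A : J → J → C)
    (hA : ∀ a b, A a b = -A b a) :
    (2 * k).factorial • ∑ f : Fin (2 * k) → J,
        pairProd A k f * pfSum k (fun a b => A (f a) (f b)) =
      (2 ^ k * k.factorial) ^ 2 • minorSum (2 * k) (Matrix.of A) := by
  have hpf (f : Fin (2 * k) → J) (τ : Equiv.Perm (Fin (2 * k))) :
      pfSum k (fun a b => A (f (τ a)) (f (τ b))) =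
        (Equiv.Perm.sign τ : ℤ) • pfSum k (fun a b => A (f a) (f b)) := by
    rw [pfSum, pfSum, ← Equiv.sum_comp (Equiv.mulLeft τ⁻¹), Finset.smul_sum]
    refine Finset.sum_congr rfl fun σ _ => ?_
    rw [smul_smul]
    congr 1
    · simp
    · simp [pairProd]
  have hsum (τ : Equiv.Perm (Fin (2 * k))) :
      ∑ f : Fin (2 * k) → J, pairProd A k f * pfSum k (fun a b => A (f a) (f b)) =
      ∑ f : Fin (2 * k) → J, ((Equiv.Perm.sign τ : ℤ) • pairProd A k (f ∘ τ)) *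
        pfSum k (fun a b => A (f a) (f b)) := by
    rw [← (τ.symm.arrowCongr (Equiv.refl J)).sum_comp]
    refine Finset.sum_congr rfl fun f _ => ?_
    rw [smul_mul_assoc, ← mul_smul_comm, ← hpf]
    rfl
  have : (2 * k).factorial • ∑ f : Fin (2 * k) → J,
        pairProd A k f * pfSum k (fun a b => A (f a) (f b)) =
      ∑ τ : Equiv.Perm (Fin (2 * k)), ∑ f : Fin (2 * k) → J,
        ((Equiv.Perm.sign τ : ℤ) • pairProd A k (f ∘ τ)) *
        pfSum k (fun a b => A (f a) (f b)) := by
    rw [← Finset.sum_congr rfl fun τ _ => hsum τ]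
    simp [Fintype.card_perm]
  rw [this, Finset.sum_comm, minorSum, Finset.smul_sum]
  refine Finset.sum_congr rfl fun f _ => ?_
  rw [← Finset.sum_mul, nsmul_eq_mul]
  refine Eq.trans ?_ (pfSum_sq k (fun a b => A (f a) (f b)) fun a b => hA _ _)
  rw [sq]
  rfl

end Minors

/-! ### The Hodge star in the middle degree -/

section Hodge

variable {V W : Type*} [NormedAddCommGroup V] [InnerProductSpace ℝ V] [FiniteDimensional ℝ V]
  [NormedAddCommGroup W] [InnerProductSpace ℝ W] [FiniteDimensional ℝ W]

variable (V) in
/-- The Riesz isomorphism as a linear isometry. -/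
def riesz : V ≃ₗᵢ[ℝ] StrongDual ℝ V where
  toFun := InnerProductSpace.toDual ℝ V
  map_add' := map_add _
  map_smul' r v := by simp
  invFun := (InnerProductSpace.toDual ℝ V).symm
  left_inv v := by simp
  right_inv v := by simp
  norm_map' v := by
    change ‖InnerProductSpace.toDual ℝ V v‖ = ‖v‖
    simp

theorem riesz_apply (v : V) : riesz V v = InnerProductSpace.toDual ℝ V v := rfl

/-- The sign `s` records the orientation of the chosen basis; later only `s * s = 1` matters. -/
theorem exists_volumeElement_eq {n : ℕ} (hn : finrank ℝ V = n) (o : Orientation ℝ V (Fin n)) :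
    ∃ (c : OrthonormalBasis (Fin n) ℝ (StrongDual ℝ V)) (s : ℝ), s * s = 1 ∧
      volumeElement hn o = s • c.toBasis.ExteriorAlgebra Finset.univ := by
  have : Fact (finrank ℝ V = n) := ⟨hn⟩
  let b : OrthonormalBasis (Fin n) ℝ V := (stdOrthonormalBasis ℝ V).reindex (finCongr hn)
  refine ⟨b.map (riesz V), o.volumeForm b, ?_, ?_⟩
  · have h := o.abs_volumeForm_apply_of_orthonormal b
    rw [← abs_mul_abs_self, h, one_mul]
  · rw [volumeElement, ExteriorAlgebra.basis_apply_ofCard (n := n) _ (by simp)]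
    congr 1
    change _ = ExteriorAlgebra.ιMulti ℝ n _
    congr 1
    ext1 i
    -- The increasing enumeration of all of `Fin n` is the identity, since an order embedding is
    -- determined by its range.
    have huniq : (Set.powersetCard.ofFinEmbEquiv.symm
        (Set.powersetCard.ofCard (show (Finset.univ : Finset (Fin n)).card = n by simp)) :
          Fin n ↪o Fin n) = RelEmbedding.refl _ := by
      rw [← OrderEmbedding.range_inj]
      ext j
      rw [Set.powersetCard.mem_range_ofFinEmbEquiv_symm_iff_mem]
      simp [← Set.powersetCard.mem_coe_iff]
    simp only [Function.comp_apply]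
    rw [huniq]
    simp [b, riesz_apply]

/-- Forms of even degree are central. -/
theorem commute_of_even {V : Type*} [NormedAddCommGroup V] [InnerProductSpace ℝ V]
    {p : ℕ} (hp : Even p) (α : Form p V) (z : ExteriorAlgebra ℝ (StrongDual ℝ V)) :
    Commute (α : ExteriorAlgebra ℝ (StrongDual ℝ V)) z := by
  obtain ⟨α, hα⟩ := α
  change Commute α z
  rw [← ExteriorAlgebra.ιMulti_span_fixedDegree] at hα
  induction hα using Submodule.span_induction with
  | mem x hx =>
    obtain ⟨u, rfl⟩ := hx
    induction z using ExteriorAlgebra.induction with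
    | algebraMap r => exact (Algebra.commutes r _).symm
    | ι m => rw [Commute, SemiconjBy, ι_mul_ιMulti, hp.neg_one_pow, one_smul]
    | mul a b ha hb => exact ha.mul_right hb
    | add a b ha hb => exact ha.add_right hb
  | zero => exact Commute.zero_left _
  | add x y _ _ hx hy => exact hx.add_left hy
  | smul r x _ hx => exact hx.smul_left r

/-- In the middle degree two disjoint index sets are complementary, by counting. The shuffle sign
itself is never needed, only its square. -/
theorem exteriorPower_mul {n p : ℕ} (hp : p + p = n)
    (c : OrthonormalBasis (Fin n) ℝ (StrongDual ℝ V)) (s t : Set.powersetCard (Fin n) p) :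
    ∃ r : ℝ, (c.exteriorPower p s : ExteriorAlgebra ℝ (StrongDual ℝ V)) * c.exteriorPower p t =
      r • c.toBasis.ExteriorAlgebra Finset.univ ∧
      r * r = if s.val = t.valᶜ then 1 else 0 := by
  have he (s : Set.powersetCard (Fin n) p) :
      (c.exteriorPower p s : ExteriorAlgebra ℝ (StrongDual ℝ V)) =
        c.toBasis.ExteriorAlgebra s := by
    rw [ExteriorAlgebra.basis_eq_coe_basis, ← OrthonormalBasis.toBasis_exteriorPower,
      OrthonormalBasis.coe_toBasis]
  have hcs : s.val.card = p := s.2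
  have hct : t.val.card = p := t.2
  rw [he, he]
  by_cases h : Disjoint s.val t.val
  · have hu : (Set.powersetCard.disjUnion h).val = Finset.univ := by
      rw [← Finset.card_eq_iff_eq_univ, Fintype.card_fin]
      exact (Set.powersetCard.disjUnion h).2.trans hp
    have hc : s.val = t.valᶜ := by
      refine Finset.eq_of_subset_of_card_le (Finset.subset_compl_iff_disjoint_right.2 h) ?_
      rw [Finset.card_compl, Fintype.card_fin]
      omega
    refine ⟨((Set.powersetCard.permOfDisjoint h).sign : ℤ), ?_, ?_⟩
    · rw [ExteriorAlgebra.basis_mul_of_disjoint, hu, Units.smul_def, Int.cast_smul_eq_zsmul]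
    · rw [if_pos hc]
      rcases Int.units_eq_one_or (Set.powersetCard.permOfDisjoint h).sign with h | h <;> simp [h]
  · refine ⟨0, ?_, ?_⟩
    · rw [ExteriorAlgebra.basis_mul_of_not_disjoint _ _ _ h, zero_smul]
    · rw [if_neg, zero_mul]
      intro h'
      rw [h'] at h
      exact h disjoint_compl_left

/-- Multiplication of forms in complementary degrees, written with the Hodge star. -/
theorem exists_hodgeStar {n p : ℕ} (hn : finrank ℝ V = n) (o : Orientation ℝ V (Fin n))
    (hp : p + p = n) (hp2 : Even p) :
    ∃ S : Form p V →ₗ[ℝ] Form p V, S.IsSymmetric ∧ (∀ α, S (S α) = α) ∧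
      ∀ α β : Form p V, (α : ExteriorAlgebra ℝ (StrongDual ℝ V)) * β =
        (inner ℝ α (S β) : ℝ) • volumeElement hn o := by
  obtain ⟨c, s, hs, hε⟩ := exists_volumeElement_eq hn o
  choose r hr hrr using exteriorPower_mul hp c
  set e := c.exteriorPower p
  -- Even forms commute; this makes the star symmetric.
  have hsym (i j) : r i j = r j i := by
    have h := (commute_of_even hp2 (e i) (e j)).eq
    rw [hr, hr] at h
    exact smul_left_injective ℝ (Basis.ne_zero _ _) h
  have hr0 (i j) (h : i.val ≠ j.valᶜ) : r i j = 0 := by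
    have := hrr i j
    rw [if_neg h] at this
    exact mul_self_eq_zero.1 this
  -- The matrix `s * r` is forced by `α ∧ β = (α, S β) ε` on basis forms, because `ε` is `s` times
  -- the top monomial.
  let S : Form p V →ₗ[ℝ] Form p V := e.toBasis.constr ℝ fun j => ∑ i, (s * r i j) • e i
  have hS (j) : S (e j) = ∑ i, (s * r i j) • e i := by
    rw [← e.coe_toBasis]
    exact e.toBasis.constr_basis ℝ _ j
  have hSin (i j) : inner ℝ (e i) (S (e j)) = s * r i j := by
    rw [hS, e.orthonormal.inner_right_fintype]
  have hsymm : S.IsSymmetric := by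
    have h : (innerₗ (Form p V)).compl₁₂ S LinearMap.id = (innerₗ (Form p V)).compl₂ S := by
      refine LinearMap.ext_basis e.toBasis e.toBasis fun i j => ?_
      simp only [e.coe_toBasis]
      change inner ℝ (S (e i)) (e j) = inner ℝ (e i) (S (e j))
      rw [real_inner_comm, hSin, hSin, hsym]
    exact fun α β => LinearMap.congr_fun₂ h α β
  refine ⟨S, hsymm, ?_, ?_⟩
  · have h : S ∘ₗ S = LinearMap.id := by
      refine e.toBasis.ext fun j => ?_
      rw [e.coe_toBasis, LinearMap.comp_apply, LinearMap.id_apply]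
      apply e.repr.injective
      ext i
      rw [e.repr_apply_apply, e.repr_apply_apply, ← hsymm (e i) (S (e j)),
        orthonormal_iff_ite.1 e.orthonormal i j, hS i, sum_inner]
      simp only [real_inner_smul_left, hSin]
      have hterm (m) : s * r m i * (s * r m j) = r m i * r m j := by
        rw [mul_mul_mul_comm, hs, one_mul]
      simp only [hterm]
      split_ifs with hij
      · subst hij
        have hcard : (i.valᶜ).card = p := by
          have : i.val.card = p := i.2
          rw [Finset.card_compl, Fintype.card_fin]
          omega
        -- Each row of `r` has one nonzero entry, at the complement, and that entry squares to 1.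
        rw [Finset.sum_eq_single (⟨i.valᶜ, hcard⟩ : Set.powersetCard (Fin n) p), hrr, if_pos rfl]
        · intro m _ hm
          rw [hr0 m i fun h => hm (Subtype.ext h), zero_mul]
        · simp
      · refine Finset.sum_eq_zero fun m _ => ?_
        by_cases hm : m.val = i.valᶜ
        · rw [hr0 m j, mul_zero]
          intro h
          exact hij (Subtype.ext (compl_injective (hm.symm.trans h)))
        · rw [hr0 m i hm, zero_mul]
    exact fun α => LinearMap.congr_fun h α
  · have hmul := LinearMap.ext_basis
      (B := (LinearMap.mul ℝ (ExteriorAlgebra ℝ (StrongDual ℝ V))).compl₁₂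
      (⋀[ℝ]^p (StrongDual ℝ V)).subtype (⋀[ℝ]^p (StrongDual ℝ V)).subtype)
      (B' := ((innerₗ (Form p V)).compl₂ S).compr₂
        (LinearMap.toSpanSingleton ℝ _ (volumeElement hn o))) e.toBasis e.toBasis ?_
    · exact fun α β => LinearMap.congr_fun₂ hmul α β
    · intro i j
      rw [e.coe_toBasis]
      change (e i : ExteriorAlgebra ℝ (StrongDual ℝ V)) * e j = (inner ℝ (e i) (S (e j)) : ℝ) • _
      rw [hr, hSin, hε, smul_smul, mul_right_comm, hs, one_mul]

theorem volumeElement_ne_zero {n : ℕ} (hn : finrank ℝ V = n) (o : Orientation ℝ V (Fin n)) :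
    volumeElement hn o ≠ 0 := by
  obtain ⟨c, s, hs, hε⟩ := exists_volumeElement_eq hn o
  rw [hε]
  refine smul_ne_zero ?_ (Basis.ne_zero _ _)
  rintro rfl
  simp at hs

/-- For a symmetric involution the orthogonal projection to the `c`-eigenspace, `c = ±1`, is `(1 + c
S) / 2`. Nondegeneracy of the inner product and `ε ≠ 0` identify `dualityEigenspace` with that
eigenspace. -/
theorem starProjection_dualityEigenspace {ε : ExteriorAlgebra ℝ (StrongDual ℝ V)} (hε : ε ≠ 0)
    {p : ℕ} {S : Form p V →ₗ[ℝ] Form p V} (hS : S.IsSymmetric) (hSS : ∀ α, S (S α) = α)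
    (hmul : ∀ α β : Form p V, (α : ExteriorAlgebra ℝ (StrongDual ℝ V)) * β =
      (inner ℝ α (S β) : ℝ) • ε) {c : ℝ} (hc : c * c = 1) (β : Form p V) :
    (dualityEigenspace ε p c).starProjection β = (1 / 2 : ℝ) • (β + c • S β) := by
  have hmem (γ : Form p V) : γ ∈ dualityEigenspace ε p c ↔ c • S γ = γ := by
    change (∀ α : Form p V, _ = _) ↔ _
    simp only [hmul, map_smul]
    constructor
    · intro h
      refine ext_inner_left ℝ fun α => ?_
      exact smul_left_injective ℝ hε (h α)
    · intro h α
      rw [h]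
  refine Submodule.eq_starProjection_of_mem_of_inner_eq_zero ?_ ?_
  · rw [hmem]
    simp only [map_smul, map_add, hSS]
    rw [smul_comm, smul_add, smul_smul, hc, one_smul, add_comm]
  · intro γ hγ
    rw [hmem] at hγ
    have h : inner ℝ (c • S β) γ = inner ℝ β γ := by
      rw [real_inner_smul_left, hS β γ, ← real_inner_smul_right, hγ]
    rw [inner_sub_left, real_inner_smul_left, inner_add_left, h]
    ring

theorem isSymmetric_map {E F : Type*} [NormedAddCommGroup E] [InnerProductSpace ℝ E]
    [NormedAddCommGroup F] [InnerProductSpace ℝ F] {f : E →ₗ[ℝ] E} {g : F →ₗ[ℝ] F}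
    (hf : f.IsSymmetric) (hg : g.IsSymmetric) : (TensorProduct.map f g).IsSymmetric := by
  intro x y
  induction x with
  | zero => simp
  | add x₁ x₂ h₁ h₂ => simp [inner_add_left, h₁, h₂]
  | tmul a b =>
    induction y with
    | zero => simp
    | add y₁ y₂ h₁ h₂ => simp only [map_add, inner_add_right, h₁, h₂]
    | tmul a' b' => simp [hf a a', hg b b']

theorem norm_sq_starProjection_map {E F : Type*} [NormedAddCommGroup E] [InnerProductSpace ℝ E]
    [NormedAddCommGroup F] [InnerProductSpace ℝ F] {P : E →ₗ[ℝ] E} {Q : F →ₗ[ℝ] F}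
    (hP : P.IsSymmetric) (hQ : Q.IsSymmetric) (hPP : P ∘ₗ P = P) (hQQ : Q ∘ₗ Q = Q) (T : E ⊗[ℝ] F) :
    ‖TensorProduct.map P Q T‖ ^ 2 = inner ℝ T (TensorProduct.map P Q T) := by
  rw [← real_inner_self_eq_norm_sq, isSymmetric_map hP hQ, ← LinearMap.comp_apply,
    ← TensorProduct.map_comp, hPP, hQQ]

variable {p q : ℕ}

theorem starProjection_isSymmetric (A : Submodule ℝ (Form p V)) :
    (A.starProjection : Form p V →ₗ[ℝ] Form p V).IsSymmetric :=
  A.starProjection_isSymmetric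

theorem starProjection_comp_self (A : Submodule ℝ (Form p V)) :
    (A.starProjection : Form p V →ₗ[ℝ] Form p V) ∘ₗ
      (A.starProjection : Form p V →ₗ[ℝ] Form p V) = A.starProjection := by
  refine LinearMap.ext fun v => ?_
  exact Submodule.starProjection_eq_self_iff.2 (A.starProjection_apply_mem v)

theorem norm_sq_leftPart (A : Submodule ℝ (Form p V)) (T : BiForm p q V W) :
    ‖leftPart A T‖ ^ 2 = innerₗ (BiForm p q V W) T (leftPart A T) :=
  norm_sq_starProjection_map (starProjection_isSymmetric A) LinearMap.IsSymmetric.id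
    (starProjection_comp_self A) rfl T

theorem norm_sq_bothParts (A : Submodule ℝ (Form p V)) (B : Submodule ℝ (Form q W))
    (T : BiForm p q V W) :
    ‖bothParts A B T‖ ^ 2 = innerₗ (BiForm p q V W) T (bothParts A B T) :=
  norm_sq_starProjection_map (starProjection_isSymmetric A) (starProjection_isSymmetric B)
    (starProjection_comp_self A) (starProjection_comp_self B) T

/-- The difference of the squared norms of the self-dual and the anti-self-dual parts. -/
theorem norm_sq_selfDual_sub {n : ℕ} (hn : finrank ℝ V = n) (o : Orientation ℝ V (Fin n))
    (hp : p + p = n) (hp2 : Even p) {J : Type*} [Fintype J] (φ : J → Form p V) (ψ : J → Form q W) :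
    (‖leftPart (selfDual (volumeElement hn o) p) (∑ j, φ j ⊗ₜ[ℝ] ψ j)‖ ^ 2 -
      ‖leftPart (antiSelfDual (volumeElement hn o) p) (∑ j, φ j ⊗ₜ[ℝ] ψ j)‖ ^ 2) •
        volumeElement hn o =
      ∑ i, ∑ j, (inner ℝ (ψ i) (ψ j) : ℝ) •
        ((φ i : ExteriorAlgebra ℝ (StrongDual ℝ V)) * φ j) := by
  obtain ⟨S, hS, hSS, hmul⟩ := exists_hodgeStar hn o hp hp2
  have hproj {c : ℝ} (hc : c * c = 1) (T : BiForm p q V W) :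
      leftPart (dualityEigenspace (volumeElement hn o) p c) T =
        (1 / 2 : ℝ) • (T + c • TensorProduct.map S LinearMap.id T) := by
    have : ((dualityEigenspace (volumeElement hn o) p c).starProjection :
        Form p V →ₗ[ℝ] Form p V) = (1 / 2 : ℝ) • (LinearMap.id + c • S) :=
      LinearMap.ext fun β =>
        starProjection_dualityEigenspace (volumeElement_ne_zero hn o) hS hSS hmul hc β
    rw [leftPart, this, TensorProduct.map_smul_left, TensorProduct.map_add_left,
      TensorProduct.map_smul_left, TensorProduct.map_id]
    rfl
  -- The difference of the two projections is the star itself, so the difference of squared norms is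
  -- `(T, (S ⊗ 1) T)`.
  have hadd (T : BiForm p q V W) : leftPart (selfDual (volumeElement hn o) p) T =
      TensorProduct.map S LinearMap.id T + leftPart (antiSelfDual (volumeElement hn o) p) T := by
    rw [hproj (by norm_num), hproj (by norm_num)]
    module
  rw [norm_sq_leftPart, norm_sq_leftPart, hadd, map_add, add_sub_cancel_right]
  rw [map_sum, map_sum, LinearMap.sum_apply, Finset.sum_smul]
  refine Finset.sum_congr rfl fun i _ => ?_
  rw [map_sum, Finset.sum_smul]
  refine Finset.sum_congr rfl fun j _ => ?_
  rw [TensorProduct.map_tmul, innerₗ_apply_apply, TensorProduct.inner_tmul, hmul, smul_smul,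
    mul_comm]
  rfl

/-- Pythagoras: the projections to self-dual and anti-self-dual forms of `W` add up to the identity.
-/
theorem norm_sq_bothParts_add {n : ℕ} (hn : finrank ℝ W = n) (o : Orientation ℝ W (Fin n))
    (hq : q + q = n) (hq2 : Even q) (A : Submodule ℝ (Form p V)) (T : BiForm p q V W) :
    ‖bothParts A (selfDual (volumeElement hn o) q) T‖ ^ 2 +
      ‖bothParts A (antiSelfDual (volumeElement hn o) q) T‖ ^ 2 = ‖leftPart A T‖ ^ 2 := by
  obtain ⟨S, hS, hSS, hmul⟩ := exists_hodgeStar hn o hq hq2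
  rw [norm_sq_bothParts, norm_sq_bothParts, norm_sq_leftPart, ← map_add]
  congr 1
  rw [bothParts, bothParts, leftPart, ← LinearMap.add_apply, ← TensorProduct.map_add_right]
  congr 2
  refine LinearMap.ext fun β => ?_
  change (dualityEigenspace _ q 1).starProjection β +
    (dualityEigenspace _ q (-1)).starProjection β = β
  rw [starProjection_dualityEigenspace (volumeElement_ne_zero hn o) hS hSS hmul (by norm_num),
    starProjection_dualityEigenspace (volumeElement_ne_zero hn o) hS hSS hmul (by norm_num)]
  module

end Hodge

/-! ### Powers of curvature-like bi-forms -/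

section Power

/-- The `2`-forms live in a commutative subalgebra of the exterior algebra. -/
theorem exists_commRing_of_two_forms.{u} (V : Type u) [NormedAddCommGroup V]
    [InnerProductSpace ℝ V] :
    ∃ (C : Type u) (_ : CommRing C) (_ : Algebra ℝ C) (_ : IsAddTorsionFree C)
      (j : C →ₐ[ℝ] ExteriorAlgebra ℝ (StrongDual ℝ V)), Function.Injective j ∧
        ∀ α : Form 2 V, ∃ c, j c = α := by
  let s : Set (ExteriorAlgebra ℝ (StrongDual ℝ V)) := ⋀[ℝ]^2 (StrongDual ℝ V)
  have : IsMulCommutative (Algebra.adjoin ℝ s) :=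
    Algebra.isMulCommutative_adjoin ℝ fun a ha b _ => (commute_of_even even_two ⟨a, ha⟩ b).eq
  refine ⟨Algebra.adjoin ℝ s,
    { (inferInstance : Ring (Algebra.adjoin ℝ s)) with mul_comm := this.is_comm.comm },
    inferInstance, ⟨fun n hn a b hab => ?_⟩,
    (Algebra.adjoin ℝ s).val, Subtype.val_injective, fun α => ⟨⟨α, Algebra.subset_adjoin α.2⟩, rfl⟩⟩
  have hab' : (n : ℝ) • a = (n : ℝ) • b := by simpa [Nat.cast_smul_eq_nsmul] using hab
  exact smul_right_injective _ (Nat.cast_ne_zero.2 hn) hab'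

variable {V W : Type*} [NormedAddCommGroup V] [InnerProductSpace ℝ V] [FiniteDimensional ℝ V]
  [NormedAddCommGroup W] [InnerProductSpace ℝ W] [FiniteDimensional ℝ W]

/-- The form `R_{f(0) f(1)} ∧ R_{f(2) f(3)} ∧ ⋯`. -/
def pairForm {J : Type*} (R : J → J → Form 2 V) : (k : ℕ) → (Fin (2 * k) → J) → Form (2 * k) V
  | 0, _ => exteriorPower.ιMulti ℝ 0 ![]
  | k + 1, f => wedge (2 * k) 2 (pairForm R k fun i => f (Fin.castAdd 2 i))
      (R (f (Fin.natAdd (2 * k) 0)) (f (Fin.natAdd (2 * k) 1)))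

theorem coe_pairForm {V : Type*} [NormedAddCommGroup V] [InnerProductSpace ℝ V]
    {J : Type*} {R : J → J → Form 2 V} {C : Type*} [CommRing C] [Algebra ℝ C]
    (j : C →ₐ[ℝ] ExteriorAlgebra ℝ (StrongDual ℝ V)) {A : J → J → C}
    (hA : ∀ a b, j (A a b) = R a b) (k : ℕ) (f : Fin (2 * k) → J) :
    (pairForm R k f : ExteriorAlgebra ℝ (StrongDual ℝ V)) = j (pairProd A k f) := by
  induction k with
  | zero => simp [pairForm, pairProd]
  | succ k ih =>
    have hf : f = (Fin.append (fun i => f (Fin.castAdd 2 i)) (fun i => f (Fin.natAdd (2 * k) i)) :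
        Fin (2 * k + 2) → J) := (Fin.append_castAdd_natAdd (f := f)).symm
    have h : pairProd A (k + 1) f = pairProd A k (fun i => f (Fin.castAdd 2 i)) *
        A (f (Fin.natAdd (2 * k) 0)) (f (Fin.natAdd (2 * k) 1)) := by
      conv_lhs => rw [hf]
      exact pairProd_succ A k _ _
    rw [h, map_mul, hA, ← ih]
    rfl

/-- The expansion is left unsorted, with redundant tuples `f`, so that no signs arise here; they
come from the inner products in `sum_inner_ιMulti_smul`. -/
theorem biPow_eq {V W : Type*} [NormedAddCommGroup V] [InnerProductSpace ℝ V]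
    [NormedAddCommGroup W] [InnerProductSpace ℝ W] {J : Type*} [Fintype J]
    (R : J → J → Form 2 V) (w : J → StrongDual ℝ W) (k : ℕ) :
    biPow ((1 / 2 : ℝ) • ∑ a, ∑ b, R a b ⊗ₜ[ℝ] exteriorPower.ιMulti ℝ 2 ![w a, w b]) k =
      ∑ f : Fin (2 * k) → J, ((1 / 2 : ℝ) ^ k • pairForm R k f) ⊗ₜ[ℝ]
        exteriorPower.ιMulti ℝ (2 * k) (w ∘ f) := by
  induction k with
  | zero =>
    simp only [biPow, pow_zero, one_smul, pairForm]
    have : IsEmpty (Fin (2 * 0)) := inferInstanceAs (IsEmpty (Fin 0))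
    rw [Fintype.sum_subsingleton _ (fun i : Fin (2 * 0) => i.elim0)]
    congr 2
    exact Subsingleton.elim _ _
  | succ k ih =>
    rw [biPow, ih]
    refine Eq.trans ?_ (sum_append (2 * k) 2 _).symm
    rw [map_sum, LinearMap.sum_apply]
    refine Finset.sum_congr rfl fun f _ => ?_
    rw [sum_finTwo, map_smul, map_sum, Finset.smul_sum]
    refine Finset.sum_congr rfl fun a _ => ?_
    rw [map_sum, Finset.smul_sum]
    refine Finset.sum_congr rfl fun b _ => ?_
    rw [biWedge, TensorProduct.map₂_apply_tmul, map_smul, TensorProduct.map_tmul,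
      LinearMap.smul_apply, TensorProduct.smul_tmul', smul_smul, ← pow_succ']
    congr 1
    · congr 1
      rw [pairForm]
      simp only [Fin.append_left, Fin.append_right]
      rfl
    · refine Subtype.ext ?_
      change ExteriorAlgebra.ιMulti ℝ (2 * k) (w ∘ f) * ExteriorAlgebra.ιMulti ℝ 2 ![w a, w b] =
        ExteriorAlgebra.ιMulti ℝ (2 * k + 2) (w ∘ Fin.append f ![a, b])
      rw [ExteriorAlgebra.ιMulti_mul_ιMulti, append_comp]
      congr 2
      ext1 i
      fin_cases i <;> rfl

theorem toForm_sum {J : Type*} [Fintype J] (c : J → ℝ) (B : J → V → V → ℝ) :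
    toForm (fun X Y => ∑ i, c i * B i X Y) = ∑ i, c i • toForm (B i) := by
  simp only [toForm, smul_comm (c _) (1 / 2 : ℝ), ← Finset.smul_sum]
  congr 1
  simp only [Finset.smul_sum, Finset.sum_smul, smul_smul]
  exact (Finset.sum_congr rfl fun i _ => Finset.sum_comm).trans Finset.sum_comm

theorem toBiForm_eq (T : V → V → W → W → ℝ) :
    toBiForm T = (1 / 2 : ℝ) • ∑ a, ∑ b, toForm (fun X Y => T X Y (stdOrthonormalBasis ℝ W a)
      (stdOrthonormalBasis ℝ W b)) ⊗ₜ[ℝ] elemForm W a b := by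
  simp only [toBiForm, toForm, TensorProduct.sum_tmul, ← TensorProduct.smul_tmul',
    ← Finset.smul_sum]
  rw [smul_smul]
  congr 1
  · norm_num
  · trans ∑ i, ∑ a, ∑ j, ∑ b,
      T (stdOrthonormalBasis ℝ V i) (stdOrthonormalBasis ℝ V j)
        (stdOrthonormalBasis ℝ W a) (stdOrthonormalBasis ℝ W b) •
      (elemForm V i j ⊗ₜ[ℝ] elemForm W a b)
    · exact Finset.sum_congr rfl fun i _ => Finset.sum_comm
    · rw [Finset.sum_comm]
      refine Finset.sum_congr rfl fun a _ => ?_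
      rw [Finset.sum_comm (γ := Fin (finrank ℝ W))]
      exact Finset.sum_congr rfl fun i _ => Finset.sum_comm

/-- The Gram determinant of two tuples from an orthonormal basis is the signed count of permutations
`σ` with `g = f ∘ σ`. This stays valid when `f` has repetitions. -/
theorem sum_inner_ιMulti_smul {J : Type*} [Fintype J] (w : OrthonormalBasis J ℝ (StrongDual ℝ W))
    {C : Type*} [CommRing C] [Algebra ℝ C] (A : J → J → C) (k : ℕ) (f : Fin (2 * k) → J) :
    ∑ g : Fin (2 * k) → J, (inner ℝ (exteriorPower.ιMulti ℝ (2 * k) (w ∘ f))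
        (exteriorPower.ιMulti ℝ (2 * k) (w ∘ g)) : ℝ) • pairProd A k g =
      pfSum k (fun a b => A (f a) (f b)) := by
  classical
  have h (g : Fin (2 * k) → J) : (inner ℝ (exteriorPower.ιMulti ℝ (2 * k) (w ∘ f))
        (exteriorPower.ιMulti ℝ (2 * k) (w ∘ g)) : ℝ) =
      ∑ σ : Equiv.Perm (Fin (2 * k)), (Equiv.Perm.sign σ : ℤ) •
        (if g = f ∘ σ then 1 else 0 : ℝ) := by
    rw [exteriorPower.inner_ιMulti_ιMulti, ← Matrix.det_transpose, Matrix.det_apply]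
    refine Finset.sum_congr rfl fun σ _ => ?_
    rw [Units.smul_def]
    congr 1
    simp only [Matrix.transpose_apply, Matrix.of_apply, Function.comp_apply,
      orthonormal_iff_ite.1 w.orthonormal]
    rw [Finset.prod_ite_zero]
    simp [funext_iff, eq_comm]
  simp only [h, Finset.sum_smul]
  rw [Finset.sum_comm, pfSum]
  refine Finset.sum_congr rfl fun σ _ => ?_
  rw [Finset.sum_eq_single (f ∘ σ)]
  · rw [if_pos rfl, smul_assoc, one_smul]
    rfl
  · intro g _ hg
    rw [if_neg hg, smul_zero, zero_smul]
  · simp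

/-- The sum of the principal minors of a curvature-like matrix of `2`-forms, in terms of the
self-dual and the anti-self-dual parts of the power of the bi-form. -/
theorem sum_minors_eq {k l : ℕ} (hn : finrank ℝ V = 4 * k) (o : Orientation ℝ V (Fin (4 * k)))
    (R : V → V → W →ₗ[ℝ] W) (hR : ∀ X Y s t, inner ℝ (R X Y t) s = -inner ℝ (R X Y s) t)
    (s : Basis (Fin l) ℝ W) :
    ∑ a : Fin (2 * k) ↪o Fin l, ∑ σ : Equiv.Perm (Fin (2 * k)), (Equiv.Perm.sign σ : ℤ) •
        (List.ofFn fun i => (toForm (fun X Y => s.coord (a i) (R X Y (s (a (σ i))))) :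
          ExteriorAlgebra ℝ (StrongDual ℝ V))).prod =
      (1 / (k.factorial : ℝ) ^ 2 *
        (‖leftPart (selfDual (volumeElement hn o) (2 * k))
            (biPow (toBiForm fun X Y s t => inner ℝ (R X Y t) s) k)‖ ^ 2 -
          ‖leftPart (antiSelfDual (volumeElement hn o) (2 * k))
            (biPow (toBiForm fun X Y s t => inner ℝ (R X Y t) s) k)‖ ^ 2)) •
        volumeElement hn o := by
  obtain ⟨C, _, _, _, j, hinj, hj⟩ := exists_commRing_of_two_forms V
  choose lift hlift using hj
  let w := stdOrthonormalBasis ℝ W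
  let Rf (c d : Fin (finrank ℝ W)) : Form 2 V := toForm fun X Y => inner ℝ (R X Y (w d)) (w c)
  let A (c d : Fin (finrank ℝ W)) : C := lift (Rf c d)
  let B : Matrix (Fin l) (Fin l) C :=
    Matrix.of fun a b => lift (toForm fun X Y => s.coord a (R X Y (s b)))
  have hjA (c d) : j (A c d) = Rf c d := hlift _
  have hjB (a b) : j (B a b) = (toForm fun X Y => s.coord a (R X Y (s b)) : Form 2 V) := hlift _
  have hA (c d) : A c d = -A d c := by
    apply hinj
    rw [map_neg, hjA, hjA, ← Submodule.coe_neg]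
    congr 1
    have h := toForm_sum (J := Unit) (fun _ => -1) fun _ X Y => inner ℝ (R X Y (w c)) (w d)
    simp only [Finset.univ_unique, Finset.sum_singleton, neg_mul, one_mul, neg_smul, one_smul] at h
    rw [← h]
    simp only [Rf, hR _ _ (w c) (w d)]
  -- Change of frame: `P` and `Q` hold the real transition coefficients between `s` and `w`, seen as
  -- scalars of `C`, so `B = P A Q` with `Q P = 1`.
  have hBA : minorSum (2 * k) B = minorSum (2 * k) (Matrix.of A) := by
    let P : Matrix (Fin l) (Fin (finrank ℝ W)) C :=
      Matrix.of fun a c => algebraMap ℝ C (s.coord a (w c))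
    let Q : Matrix (Fin (finrank ℝ W)) (Fin l) C :=
      Matrix.of fun d b => algebraMap ℝ C (inner ℝ (w d) (s b))
    have hB : B = P * (Matrix.of A * Q) := by
      ext a b
      apply hinj
      have hexp (X Y : V) : s.coord a (R X Y (s b)) =
          ∑ cd : Fin (finrank ℝ W) × Fin (finrank ℝ W),
            (s.coord a (w cd.1) * inner ℝ (w cd.2) (s b)) *
              inner ℝ (R X Y (w cd.2)) (w cd.1) := by
        rw [Fintype.sum_prod_type]
        conv_lhs => rw [← w.sum_repr' (R X Y (s b)), ← w.sum_repr' (s b)]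
        simp only [map_sum, map_smul, smul_eq_mul, inner_sum, real_inner_smul_right,
          Finset.sum_mul]
        refine Finset.sum_congr rfl fun c _ => Finset.sum_congr rfl fun d _ => ?_
        rw [real_inner_comm (w c)]
        ring
      rw [hjB]
      simp only [hexp]
      rw [toForm_sum, Fintype.sum_prod_type]
      simp only [Matrix.mul_apply, P, Q, Matrix.of_apply, map_sum, map_mul, hjA, AlgHom.commutes,
        Submodule.coe_sum, Submodule.coe_smul, Finset.mul_sum]
      refine Finset.sum_congr rfl fun c _ => Finset.sum_congr rfl fun d _ => ?_
      rw [← Algebra.commutes (inner ℝ (w d) (s b)), ← Algebra.smul_def, ← Algebra.smul_def,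
        smul_smul]
    have hQP : Q * P = 1 := by
      ext d c
      simp only [Matrix.mul_apply, P, Q, Matrix.of_apply, ← map_mul, ← map_sum]
      have : ∑ a, inner ℝ (w d) (s a) * s.coord a (w c) = inner ℝ (w d) (w c) := by
        conv_rhs => rw [← s.sum_repr (w c)]
        simp only [inner_sum, real_inner_smul_right, Basis.coord_apply, mul_comm]
      rw [this, orthonormal_iff_ite.1 w.orthonormal, Matrix.one_apply]
      split_ifs <;> simp
    rw [hB, minorSum_mul_comm, Matrix.mul_assoc, hQP, Matrix.mul_one]
  have hleft : ∑ a : Fin (2 * k) ↪o Fin l, ∑ σ : Equiv.Perm (Fin (2 * k)),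
      (Equiv.Perm.sign σ : ℤ) •
        (List.ofFn fun i => (toForm (fun X Y => s.coord (a i) (R X Y (s (a (σ i))))) :
          ExteriorAlgebra ℝ (StrongDual ℝ V))).prod =
      j (∑ a : Fin (2 * k) ↪o Fin l, (B.submatrix a a).det) := by
    rw [map_sum]
    refine Finset.sum_congr rfl fun a _ => ?_
    rw [← Matrix.det_transpose, Matrix.det_apply, map_sum]
    refine Finset.sum_congr rfl fun σ _ => ?_
    rw [Units.smul_def, map_zsmul, ← List.prod_ofFn, map_list_prod, List.map_ofFn]
    congr 3
    ext1 i
    exact (hjB _ _).symm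
  have hright := norm_sq_selfDual_sub (W := W) hn o (show 2 * k + 2 * k = 4 * k by ring)
    (even_two_mul k) (fun f => (1 / 2 : ℝ) ^ k • pairForm Rf k f)
    (fun f => exteriorPower.ιMulti ℝ (2 * k) ((w.map (riesz W)) ∘ f))
  rw [← biPow_eq Rf (w.map (riesz W)) k] at hright
  have hbi : toBiForm (fun X Y s t => inner ℝ (R X Y t) s) =
      (1 / 2 : ℝ) • ∑ a, ∑ b, Rf a b ⊗ₜ[ℝ] exteriorPower.ιMulti ℝ 2
        ![(w.map (riesz W)) a, (w.map (riesz W)) b] := by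
    rw [toBiForm_eq]
    simp only [OrthonormalBasis.map_apply]
    rfl
  rw [← hbi] at hright
  -- The sum over `g` collapses to a Pfaffian; the two factors `(1/2)^k` come from summing over all
  -- pairs of fibre indices in each copy of `R^k`.
  have hsum : ∑ f : Fin (2 * k) → Fin (finrank ℝ W), ∑ g : Fin (2 * k) → Fin (finrank ℝ W),
      (inner ℝ (exteriorPower.ιMulti ℝ (2 * k) ((w.map (riesz W)) ∘ f))
        (exteriorPower.ιMulti ℝ (2 * k) ((w.map (riesz W)) ∘ g)) : ℝ) •
      (((1 / 2 : ℝ) ^ k • pairForm Rf k f : Form (2 * k) V) *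
        ((1 / 2 : ℝ) ^ k • pairForm Rf k g : Form (2 * k) V) :
          ExteriorAlgebra ℝ (StrongDual ℝ V)) =
      (1 / 4 : ℝ) ^ k • j (∑ f, pairProd A k f * pfSum k fun a b => A (f a) (f b)) := by
    have h4 : (1 / 2 : ℝ) ^ k * (1 / 2 : ℝ) ^ k = (1 / 4 : ℝ) ^ k := by
      rw [← mul_pow]; norm_num
    rw [map_sum, Finset.smul_sum]
    refine Finset.sum_congr rfl fun f _ => ?_
    rw [← sum_inner_ιMulti_smul (w.map (riesz W)), map_mul, map_sum, Finset.mul_sum,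
      Finset.smul_sum]
    refine Finset.sum_congr rfl fun g _ => ?_
    rw [Submodule.coe_smul, Submodule.coe_smul, coe_pairForm j hjA, coe_pairForm j hjA, map_smul,
      smul_mul_smul_comm, h4, mul_smul_comm, smul_comm]
  -- Both sides acquire the factor `(2k)!`, once from averaging and once from ordering the indices,
  -- and it cancels.
  have hX : ∑ f, pairProd A k f * pfSum k (fun a b => A (f a) (f b)) =
      (2 ^ k * k.factorial) ^ 2 • ∑ a : Fin (2 * k) ↪o Fin l, (B.submatrix a a).det := by
    refine nsmul_right_injective (M := C) (Nat.factorial_ne_zero (2 * k)) ?_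
    simp only
    rw [pairProd_sum k A hA, ← hBA, minorSum_eq_factorial_nsmul, smul_comm]
  rw [hleft, mul_smul, hright, hsum, hX, map_nsmul, ← Nat.cast_smul_eq_nsmul ℝ, smul_smul,
    smul_smul, mul_assoc]
  have hone : 1 / (k.factorial : ℝ) ^ 2 *
      ((1 / 4 : ℝ) ^ k * (((2 ^ k * k.factorial) ^ 2 : ℕ) : ℝ)) =
      1 := by
    have h0 : (k.factorial : ℝ) ≠ 0 := Nat.cast_ne_zero.2 k.factorial_ne_zero
    have h4 : (4 : ℝ) ^ k = 2 ^ k * 2 ^ k := by rw [← mul_pow]; norm_num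
    push_cast
    rw [div_pow, one_pow, h4]
    field_simp
  rw [hone, one_smul]

end Power

/-! ### Second derivatives and the Lie bracket -/

section LieBracket

open VectorField

variable {E : Type*} [NormedAddCommGroup E] [NormedSpace ℝ E] [CompleteSpace E]
  {H : Type*} [TopologicalSpace H] {I : ModelWithCorners ℝ E H}
  {M : Type*} [TopologicalSpace M] [ChartedSpace H M] [IsManifold I ∞ M]

theorem differentiableAt_of_mdifferentiableAt_vectorField {E : Type*} [NormedAddCommGroup E]
    [NormedSpace ℝ E] {X : Π z : E, TangentSpace 𝓘(ℝ, E) z} {z : E}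
    (hX : MDiffAt (T% X) z) : DifferentiableAt ℝ (X : E → E) z := by
  rw [mdifferentiableAt_section] at hX
  exact (mdifferentiableAt_iff_differentiableAt (f := fun b => (X b : E))).1
    (hX.congr_of_eventuallyEq (Filter.Eventually.of_forall fun b => by
      simp; rfl))

/-- The commutator formula for the Lie bracket, in a parametrization `g`. -/
theorem mvfderiv_mlieBracket_of_parametrization {g : E → M} {z : E} {x : M} (hx : g z = x)
    (hg : ContMDiffAt 𝓘(ℝ, E) I ∞ g z)
    (hinv : ∀ᶠ y in 𝓝 z, (mfderiv 𝓘(ℝ, E) I g y).IsInvertible)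
    {X Y : Π x : M, TangentSpace I x} (hX : MDiffAt (T% X) x) (hY : MDiffAt (T% Y) x)
    {f : M → ℝ} (hf : ContMDiffAt I 𝓘(ℝ, ℝ) 2 f x)
    (hXf : MDifferentiableAt I 𝓘(ℝ, ℝ) (fun y => mvfderiv I f y (X y)) x)
    (hYf : MDifferentiableAt I 𝓘(ℝ, ℝ) (fun y => mvfderiv I f y (Y y)) x) :
    mvfderiv I f x (mlieBracket I X Y x) =
      mvfderiv I (fun y => mvfderiv I f y (Y y)) x (X x) -
        mvfderiv I (fun y => mvfderiv I f y (X y)) x (Y x) := by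
  subst hx
  have h2top : (2 : ℕ∞ω) ≤ ∞ := WithTop.coe_le_coe.2 (le_top : (2 : ℕ∞) ≤ ⊤)
  have h2 : minSmoothness ℝ 2 ≤ (∞ : ℕ∞ω) := by
    rw [minSmoothness_of_isRCLikeNormedField]; exact h2top
  have h2' : minSmoothness ℝ 2 ≤ (2 : ℕ∞ω) := by
    rw [minSmoothness_of_isRCLikeNormedField]
  have : IsManifold I (minSmoothness ℝ 2) M := IsManifold.of_le h2
  have hgd : ∀ᶠ y in 𝓝 z, MDifferentiableAt 𝓘(ℝ, E) I g y :=
    ((contMDiffAt_iff_contMDiffAt_nhds (n := 1) (by simp)).1 (hg.of_le (by simp))).mono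
      fun y hy => hy.mdifferentiableAt one_ne_zero
  have hfd : ∀ᶠ y in 𝓝 z, MDifferentiableAt I 𝓘(ℝ, ℝ) f (g y) :=
    hg.continuousAt.eventually (((contMDiffAt_iff_contMDiffAt_nhds (by simp)).1 hf).mono
      fun y hy => hy.mdifferentiableAt two_ne_zero)
  -- The derivative of `g` carries the pulled-back field to `Z`, so derivatives along `Z` become
  -- flat ones and the formula reduces to the one in `E`.
  have hchain (h : M → ℝ) (Z : Π x : M, TangentSpace I x) (y : E)
      (hgy : MDifferentiableAt 𝓘(ℝ, E) I g y) (hhy : MDifferentiableAt I 𝓘(ℝ, ℝ) h (g y))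
      (hy : (mfderiv 𝓘(ℝ, E) I g y).IsInvertible) :
      fderiv ℝ (h ∘ g) y (mpullback 𝓘(ℝ, E) I g Z y) = mvfderiv I h (g y) (Z (g y)) := by
    rw [← mfderiv_eq_fderiv]
    refine (mvfderiv_comp_apply y hhy hgy _).trans ?_
    rw [mpullback_apply, hy.self_apply_inverse]
  have hev (Z : Π x : M, TangentSpace I x) :
      (fun y => fderiv ℝ (f ∘ g) y (mpullback 𝓘(ℝ, E) I g Z y)) =ᶠ[𝓝 z]
        (fun y => mvfderiv I f y (Z y)) ∘ g := by
    filter_upwards [hgd, hfd, hinv] with y h1 h2 h3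
    exact hchain f Z y h1 h2 h3
  have hdiff {Z : Π x : M, TangentSpace I x} (hZ : MDiffAt (T% Z) (g z)) :
      DifferentiableAt ℝ (mpullback 𝓘(ℝ, E) I g Z : E → E) z :=
    differentiableAt_of_mdifferentiableAt_vectorField
      (hZ.mpullback_vectorField hg hinv.self_of_nhds h2top)
  have hbr : mpullback 𝓘(ℝ, E) I g (mlieBracket I X Y) z =
      lieBracket ℝ (mpullback 𝓘(ℝ, E) I g X) (mpullback 𝓘(ℝ, E) I g Y) z := by
    rw [mpullback_mlieBracket hX hY hg h2, ← mlieBracketWithin_univ,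
      mlieBracketWithin_eq_lieBracketWithin]
    exact congrFun lieBracketWithin_univ z
  have hfg : ContDiffAt ℝ 2 (f ∘ g) z :=
    (hf.comp z (hg.of_le h2top)).contDiffAt
  have key := fderiv_apply_lieBracket hfg h2' (hdiff hY) (hdiff hX)
  rw [← hbr, hchain f _ z hgd.self_of_nhds hfd.self_of_nhds hinv.self_of_nhds,
    (hev X).fderiv_eq, (hev Y).fderiv_eq,
    hchain _ _ z hgd.self_of_nhds hXf hinv.self_of_nhds,
    hchain _ _ z hgd.self_of_nhds hYf hinv.self_of_nhds] at key
  exact key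

/-- The inverse chart serves as parametrization; without boundary its derivative within the model
range is an ordinary derivative. -/
theorem mvfderiv_mlieBracket [I.Boundaryless] {x : M}
    {X Y : Π x : M, TangentSpace I x} (hX : MDiffAt (T% X) x) (hY : MDiffAt (T% Y) x)
    {f : M → ℝ} (hf : ContMDiffAt I 𝓘(ℝ, ℝ) 2 f x)
    (hXf : MDifferentiableAt I 𝓘(ℝ, ℝ) (fun y => mvfderiv I f y (X y)) x)
    (hYf : MDifferentiableAt I 𝓘(ℝ, ℝ) (fun y => mvfderiv I f y (Y y)) x) :
    mvfderiv I f x (mlieBracket I X Y x) =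
      mvfderiv I (fun y => mvfderiv I f y (Y y)) x (X x) -
        mvfderiv I (fun y => mvfderiv I f y (X y)) x (Y x) := by
  refine mvfderiv_mlieBracket_of_parametrization (extChartAt_to_inv (I := I) x)
    ((contMDiffOn_extChartAt_symm x).contMDiffAt (extChartAt_target_mem_nhds x)) ?_ hX hY hf hXf hYf
  filter_upwards [extChartAt_target_mem_nhds (I := I) x] with y hy
  have h := isInvertible_mfderivWithin_extChartAt_symm (I := I) hy
  rwa [I.range_eq_univ, mfderivWithin_univ] at h

end LieBracket

/-! ### Smoothness of covariant derivatives -/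

section Extension

variable {B : Type*} [TopologicalSpace B] {F : Type*} [NormedAddCommGroup F] [NormedSpace ℝ F]
  {V : B → Type*} [TopologicalSpace (TotalSpace F V)] [∀ x, AddCommGroup (V x)]
  [∀ x, Module ℝ (V x)] [∀ x, TopologicalSpace (V x)] [FiberBundle F V] [VectorBundle ℝ F V]

/-- Written this way the extension is visibly linear in `v`, but only over the base set; hence the
additivity and homogeneity below hold only near `x`. -/
theorem extend_eq_symmₗ {x y : B} (hy : y ∈ (trivializationAt F V x).baseSet) (v : V x) :
    FiberBundle.extend F v y = (trivializationAt F V x).symmₗ ℝ y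
      ((trivializationAt F V x).linearMapAt ℝ x v) := by
  rw [Trivialization.coe_linearMapAt_of_mem _ (FiberBundle.mem_baseSet_trivializationAt F V x),
    Trivialization.symmₗ_apply _ hy]
  rfl

theorem extend_add {x : B} (v w : V x) :
    ∀ᶠ y in 𝓝 x, FiberBundle.extend F (v + w) y =
      (FiberBundle.extend F v + FiberBundle.extend F w) y := by
  filter_upwards [(trivializationAt F V x).open_baseSet.mem_nhds
    (FiberBundle.mem_baseSet_trivializationAt F V x)] with y hy
  simp only [extend_eq_symmₗ hy, map_add, Pi.add_apply]

theorem extend_smul {x : B} (c : ℝ) (v : V x) :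
    ∀ᶠ y in 𝓝 x, FiberBundle.extend F (c • v) y = (c • FiberBundle.extend F v) y := by
  filter_upwards [(trivializationAt F V x).open_baseSet.mem_nhds
    (FiberBundle.mem_baseSet_trivializationAt F V x)] with y hy
  simp only [extend_eq_symmₗ hy, map_smul, Pi.smul_apply]

theorem eventually_contMDiffAt_extend {E : Type*} [NormedAddCommGroup E] [NormedSpace ℝ E]
    {H : Type*} [TopologicalSpace H] {I : ModelWithCorners ℝ E H} [ChartedSpace H B]
    [ContMDiffVectorBundle ∞ F V I] {x : B} (v : V x) :
    ∀ᶠ y in 𝓝 x, ContMDiffAt I (I.prod 𝓘(ℝ, F)) ∞ (T% (FiberBundle.extend F v)) y := by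
  obtain ⟨u, hu, h⟩ := FiberBundle.exists_contMDiffOn_extend (k := ∞) I F v
  filter_upwards [eventually_mem_nhds_iff.2 hu] with y hy
  exact h.contMDiffAt hy

end Extension

theorem mvfderiv_congr {E : Type*} [NormedAddCommGroup E] [NormedSpace ℝ E]
    {H : Type*} [TopologicalSpace H] {I : ModelWithCorners ℝ E H}
    {M : Type*} [TopologicalSpace M] [ChartedSpace H M] {f g : M → ℝ} {x : M}
    (h : f =ᶠ[𝓝 x] g) : mvfderiv I f x = mvfderiv I g x :=
  h.mfderiv_eq

/-! ### Curvature as a skew endomorphism of the fibre -/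

section Curvature

variable {E : Type*} [NormedAddCommGroup E] [NormedSpace ℝ E] [FiniteDimensional ℝ E]
  {H : Type*} [TopologicalSpace H] {I : ModelWithCorners ℝ E H}
  {M : Type*} [TopologicalSpace M] [T2Space M] [ChartedSpace H M] [IsManifold I ∞ M]
  {F : Type*} [NormedAddCommGroup F] [NormedSpace ℝ F]
  {V : M → Type*} [TopologicalSpace (TotalSpace F V)]
  [∀ x, NormedAddCommGroup (V x)] [∀ x, InnerProductSpace ℝ (V x)]
  [FiberBundle F V] [VectorBundle ℝ F V]

/-- Smoothness of `D` is applied to global sections, so `σ` is cut off by a bump function equal to 1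
near `x`, and locality of `D` finishes. The hypothesis is on a neighbourhood because being smooth at
a single point does not provide one. -/
theorem contMDiffAt_covariantDerivative (D : CovariantDerivative I F V)
    [D.ContMDiffCovariantDerivative ∞] {σ : Π x : M, V x} {x : M}
    (hσ : ∀ᶠ y in 𝓝 x, ContMDiffAt I (I.prod 𝓘(ℝ, F)) ∞ (T% σ) y) :
    ContMDiffAt I (I.prod 𝓘(ℝ, E →L[ℝ] F)) ∞
      (fun y => (⟨y, D σ y⟩ : TotalSpace (E →L[ℝ] F) fun y => TangentSpace I y →L[ℝ] V y)) x := by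
  obtain ⟨u, hu, huo, hxu⟩ := eventually_nhds_iff.1 hσ
  obtain ⟨χ, -, hχ⟩ := (SmoothBumpFunction.nhds_basis_tsupport (I := I) x).mem_iff.1
    (huo.mem_nhds hxu)
  have hglob : ContMDiff I (I.prod 𝓘(ℝ, F)) ∞ (T% ((χ : M → ℝ) • σ)) :=
    ContMDiffOn.smul_section_of_tsupport χ.contMDiff.contMDiffOn huo hχ
      fun y hy => (hu y hy).contMDiffWithinAt
  have hD := (‹D.ContMDiffCovariantDerivative ∞›.contMDiff.contMDiff
    (σ := (χ : M → ℝ) • σ) hglob.contMDiffOn).contMDiffAt (x := x) Filter.univ_mem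
  refine hD.congr_of_eventuallyEq ?_
  filter_upwards [χ.eventuallyEq_one.eventually_nhds, hσ] with y hy hσy
  congr 1
  refine D.isCovariantDerivativeOn.congr_of_eventuallyEq (s := Set.univ)
    (hσy.mdifferentiableAt (by simp)) ((hglob y).mdifferentiableAt (by simp)) Filter.univ_mem ?_
  filter_upwards [hy] with z hz
  simp [hz]

theorem contMDiffAt_covariantDerivative_apply (D : CovariantDerivative I F V)
    [D.ContMDiffCovariantDerivative ∞] {σ : Π x : M, V x} {X : Π x : M, TangentSpace I x} {x : M}
    (hσ : ∀ᶠ y in 𝓝 x, ContMDiffAt I (I.prod 𝓘(ℝ, F)) ∞ (T% σ) y)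
    (hX : ContMDiffAt I (I.prod 𝓘(ℝ, E)) ∞ (T% X) x) :
    ContMDiffAt I (I.prod 𝓘(ℝ, F)) ∞ (T% fun y => D σ y (X y)) x :=
  (contMDiffAt_covariantDerivative D hσ).clm_bundle_apply hX

/-- The local extensions are linear in the vector only near the point, so linearity of `curvatureAt`
needs the curvature to depend only on the germ of the section. -/
theorem curvature_congr (D : CovariantDerivative I F V) [D.ContMDiffCovariantDerivative ∞]
    {σ τ : Π x : M, V x} {X Y : Π x : M, TangentSpace I x} {x : M}
    (hσ : ∀ᶠ y in 𝓝 x, ContMDiffAt I (I.prod 𝓘(ℝ, F)) ∞ (T% σ) y)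
    (hτ : ∀ᶠ y in 𝓝 x, ContMDiffAt I (I.prod 𝓘(ℝ, F)) ∞ (T% τ) y)
    (hX : ContMDiffAt I (I.prod 𝓘(ℝ, E)) ∞ (T% X) x)
    (hY : ContMDiffAt I (I.prod 𝓘(ℝ, E)) ∞ (T% Y) x) (hστ : ∀ᶠ y in 𝓝 x, σ y = τ y) :
    curvature D X Y σ x = curvature D X Y τ x := by
  have heq : ∀ᶠ y in 𝓝 x, D σ y = D τ y := by
    filter_upwards [hσ, hτ, hστ.eventually_nhds] with y h1 h2 h3
    exact D.isCovariantDerivativeOn.congr_of_eventuallyEq (s := Set.univ)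
      (h1.mdifferentiableAt (by simp)) (h2.mdifferentiableAt (by simp)) Filter.univ_mem h3
  have key {Z : Π x : M, TangentSpace I x} (hZ : ContMDiffAt I (I.prod 𝓘(ℝ, E)) ∞ (T% Z) x) :
      D (fun y => D σ y (Z y)) x = D (fun y => D τ y (Z y)) x := by
    refine D.isCovariantDerivativeOn.congr_of_eventuallyEq (s := Set.univ)
      ((contMDiffAt_covariantDerivative_apply D hσ hZ).mdifferentiableAt (by simp))
      ((contMDiffAt_covariantDerivative_apply D hτ hZ).mdifferentiableAt (by simp))
      Filter.univ_mem ?_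
    filter_upwards [heq] with y hy
    rw [hy]
  simp only [curvature, key hX, key hY, heq.self_of_nhds]

theorem curvature_add (D : CovariantDerivative I F V) [D.ContMDiffCovariantDerivative ∞]
    {σ τ : Π x : M, V x} {X Y : Π x : M, TangentSpace I x} {x : M}
    (hσ : ∀ᶠ y in 𝓝 x, ContMDiffAt I (I.prod 𝓘(ℝ, F)) ∞ (T% σ) y)
    (hτ : ∀ᶠ y in 𝓝 x, ContMDiffAt I (I.prod 𝓘(ℝ, F)) ∞ (T% τ) y)
    (hX : ContMDiffAt I (I.prod 𝓘(ℝ, E)) ∞ (T% X) x)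
    (hY : ContMDiffAt I (I.prod 𝓘(ℝ, E)) ∞ (T% Y) x) :
    curvature D X Y (σ + τ) x = curvature D X Y σ x + curvature D X Y τ x := by
  have hadd : ∀ᶠ y in 𝓝 x, D (σ + τ) y = D σ y + D τ y := by
    filter_upwards [hσ, hτ] with y h1 h2
    exact D.isCovariantDerivativeOn.add (s := Set.univ) (h1.mdifferentiableAt (by simp))
      (h2.mdifferentiableAt (by simp))
  have hστ : ∀ᶠ y in 𝓝 x, ContMDiffAt I (I.prod 𝓘(ℝ, F)) ∞ (T% (σ + τ)) y := by
    filter_upwards [hσ, hτ] with y h1 h2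
    exact h1.add_section h2
  have key {Z : Π x : M, TangentSpace I x} (hZ : ContMDiffAt I (I.prod 𝓘(ℝ, E)) ∞ (T% Z) x) :
      D (fun y => D (σ + τ) y (Z y)) x =
        D (fun y => D σ y (Z y)) x + D (fun y => D τ y (Z y)) x := by
    have h1 := contMDiffAt_covariantDerivative_apply D hσ hZ
    have h2 := contMDiffAt_covariantDerivative_apply D hτ hZ
    have h3 := contMDiffAt_covariantDerivative_apply D hστ hZ
    rw [← D.isCovariantDerivativeOn.add (s := Set.univ) (h1.mdifferentiableAt (by simp))
      (h2.mdifferentiableAt (by simp))]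
    refine D.isCovariantDerivativeOn.congr_of_eventuallyEq (s := Set.univ)
      (h3.mdifferentiableAt (by simp)) ((h1.add_section h2).mdifferentiableAt (by simp))
      Filter.univ_mem ?_
    filter_upwards [hadd] with y hy
    simp [hy]
  simp only [curvature, key hX, key hY, hadd.self_of_nhds, add_apply]
  abel

theorem curvature_const_smul (D : CovariantDerivative I F V) [D.ContMDiffCovariantDerivative ∞]
    {σ : Π x : M, V x} {X Y : Π x : M, TangentSpace I x} {x : M} (c : ℝ)
    (hσ : ∀ᶠ y in 𝓝 x, ContMDiffAt I (I.prod 𝓘(ℝ, F)) ∞ (T% σ) y)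
    (hX : ContMDiffAt I (I.prod 𝓘(ℝ, E)) ∞ (T% X) x)
    (hY : ContMDiffAt I (I.prod 𝓘(ℝ, E)) ∞ (T% Y) x) :
    curvature D X Y (c • σ) x = c • curvature D X Y σ x := by
  have hsmul : ∀ᶠ y in 𝓝 x, D (c • σ) y = c • D σ y := by
    filter_upwards [hσ] with y h1
    exact D.isCovariantDerivativeOn.smul_const (s := Set.univ) c (h1.mdifferentiableAt (by simp))
  have hcσ : ∀ᶠ y in 𝓝 x, ContMDiffAt I (I.prod 𝓘(ℝ, F)) ∞ (T% (c • σ)) y := by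
    filter_upwards [hσ] with y h1
    exact h1.const_smul_section
  have key {Z : Π x : M, TangentSpace I x} (hZ : ContMDiffAt I (I.prod 𝓘(ℝ, E)) ∞ (T% Z) x) :
      D (fun y => D (c • σ) y (Z y)) x = c • D (fun y => D σ y (Z y)) x := by
    have h1 := contMDiffAt_covariantDerivative_apply D hσ hZ
    have h3 := contMDiffAt_covariantDerivative_apply D hcσ hZ
    rw [← D.isCovariantDerivativeOn.smul_const (s := Set.univ) c (h1.mdifferentiableAt (by simp))]
    refine D.isCovariantDerivativeOn.congr_of_eventuallyEq (s := Set.univ)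
      (h3.mdifferentiableAt (by simp)) (h1.const_smul_section.mdifferentiableAt (by simp))
      Filter.univ_mem ?_
    filter_upwards [hsmul] with y hy
    simp [hy]
  simp only [curvature, key hX, key hY, hsmul.self_of_nhds, smul_apply,
    smul_sub]

variable [ContMDiffVectorBundle ∞ F V I]

/-- The curvature at a point, as an endomorphism of the fibre. -/
def curvatureEnd (D : CovariantDerivative I F V) [D.ContMDiffCovariantDerivative ∞] (x : M)
    (X Y : TangentSpace I x) : V x →ₗ[ℝ] V x where
  toFun := curvatureAt D x X Y
  map_add' s t := by
    have hs := eventually_contMDiffAt_extend (I := I) (F := F) s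
    have ht := eventually_contMDiffAt_extend (I := I) (F := F) t
    have hX := FiberBundle.contMDiffAt_extend (k := ∞) I E X
    have hY := FiberBundle.contMDiffAt_extend (k := ∞) I E Y
    refine (curvature_congr D (eventually_contMDiffAt_extend (s + t)) ?_ hX hY
      (extend_add s t)).trans (curvature_add D hs ht hX hY)
    filter_upwards [hs, ht] with y h1 h2
    exact h1.add_section h2
  map_smul' c s := by
    have hs := eventually_contMDiffAt_extend (I := I) (F := F) s
    have hX := FiberBundle.contMDiffAt_extend (k := ∞) I E X
    have hY := FiberBundle.contMDiffAt_extend (k := ∞) I E Y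
    refine (curvature_congr D (eventually_contMDiffAt_extend (c • s)) ?_ hX hY
      (extend_smul c s)).trans (curvature_const_smul D c hs hX hY)
    filter_upwards [hs] with y h1
    exact h1.const_smul_section

variable [FiniteDimensional ℝ F] [IsContMDiffRiemannianBundle I ∞ F V]

/-- Apply `[X, Y] = XY - YX` to the function `(σ, τ)` and expand by metric compatibility: the mixed
terms `(D_X σ, D_Y τ)` and `(D_Y σ, D_X τ)` cancel, leaving `(R σ, τ) + (σ, R τ) = 0`. -/
theorem inner_curvature (D : CovariantDerivative I F V) [D.ContMDiffCovariantDerivative ∞]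
    [I.Boundaryless] (hD : D.IsMetricCompatible)
    {σ τ : Π x : M, V x} {X Y : Π x : M, TangentSpace I x} {x : M}
    (hσ : ∀ᶠ y in 𝓝 x, ContMDiffAt I (I.prod 𝓘(ℝ, F)) ∞ (T% σ) y)
    (hτ : ∀ᶠ y in 𝓝 x, ContMDiffAt I (I.prod 𝓘(ℝ, F)) ∞ (T% τ) y)
    (hX : ContMDiffAt I (I.prod 𝓘(ℝ, E)) ∞ (T% X) x)
    (hY : ContMDiffAt I (I.prod 𝓘(ℝ, E)) ∞ (T% Y) x) :
    inner ℝ (curvature D X Y τ x) (σ x) = -inner ℝ (curvature D X Y σ x) (τ x) := by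
  have hσ' := hσ.self_of_nhds.mdifferentiableAt (by simp)
  have hτ' := hτ.self_of_nhds.mdifferentiableAt (by simp)
  have hf : ContMDiffAt I 𝓘(ℝ, ℝ) ∞ (fun y => inner ℝ (σ y) (τ y)) x :=
    hσ.self_of_nhds.inner_bundle hτ.self_of_nhds
  have first (Z : Π x : M, TangentSpace I x) :
      (fun y => mvfderiv I (fun y => inner ℝ (σ y) (τ y)) y (Z y)) =ᶠ[𝓝 x]
        fun y => inner ℝ (D σ y (Z y)) (τ y) + inner ℝ (σ y) (D τ y (Z y)) := by
    filter_upwards [hσ, hτ] with y h1 h2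
    exact hD.mvfderiv_inner_eq Z (h1.mdifferentiableAt (by simp)) (h2.mdifferentiableAt (by simp))
  have hdσ {Z : Π x : M, TangentSpace I x} (hZ : ContMDiffAt I (I.prod 𝓘(ℝ, E)) ∞ (T% Z) x) :=
    (contMDiffAt_covariantDerivative_apply D hσ hZ).mdifferentiableAt (n := ∞) (by simp)
  have hdτ {Z : Π x : M, TangentSpace I x} (hZ : ContMDiffAt I (I.prod 𝓘(ℝ, E)) ∞ (T% Z) x) :=
    (contMDiffAt_covariantDerivative_apply D hτ hZ).mdifferentiableAt (n := ∞) (by simp)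
  have hd {Z : Π x : M, TangentSpace I x} (hZ : ContMDiffAt I (I.prod 𝓘(ℝ, E)) ∞ (T% Z) x) :
      MDifferentiableAt I 𝓘(ℝ, ℝ)
        (fun y => mvfderiv I (fun y => inner ℝ (σ y) (τ y)) y (Z y)) x :=
    (((hdσ hZ).inner_bundle hτ').add (hσ'.inner_bundle (hdτ hZ))).congr_of_eventuallyEq (first Z)
  have second {W Z : Π x : M, TangentSpace I x}
      (hZ : ContMDiffAt I (I.prod 𝓘(ℝ, E)) ∞ (T% Z) x) :
      mvfderiv I (fun y => mvfderiv I (fun y => inner ℝ (σ y) (τ y)) y (Z y)) x (W x) =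
        inner ℝ (D (fun y => D σ y (Z y)) x (W x)) (τ x) +
          inner ℝ (D σ x (Z x)) (D τ x (W x)) +
        (inner ℝ (D σ x (W x)) (D τ x (Z x)) +
          inner ℝ (σ x) (D (fun y => D τ y (Z y)) x (W x))) := by
    rw [mvfderiv_congr (first Z), mvfderiv_fun_add ((hdσ hZ).inner_bundle hτ')
      (hσ'.inner_bundle (hdτ hZ)), add_apply,
      hD.mvfderiv_inner_eq W (hdσ hZ) hτ', hD.mvfderiv_inner_eq W hσ' (hdτ hZ)]
  have key := mvfderiv_mlieBracket (hX.mdifferentiableAt (by simp)) (hY.mdifferentiableAt (by simp))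
    (hf.of_le (WithTop.coe_le_coe.2 (le_top : (2 : ℕ∞) ≤ ⊤))) (hd hX) (hd hY)
  rw [second hX, second hY, hD.mvfderiv_inner_eq _ hσ' hτ'] at key
  simp only [curvature, inner_sub_left]
  simp only [real_inner_comm (σ x)] at key ⊢
  linear_combination -key

theorem inner_curvatureAt (D : CovariantDerivative I F V) [D.ContMDiffCovariantDerivative ∞]
    [I.Boundaryless] (hD : D.IsMetricCompatible) (x : M) (X Y : TangentSpace I x) (s t : V x) :
    inner ℝ (curvatureAt D x X Y t) s = -inner ℝ (curvatureAt D x X Y s) t := by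
  have h := inner_curvature D hD (eventually_contMDiffAt_extend s) (eventually_contMDiffAt_extend t)
    (FiberBundle.contMDiffAt_extend I E X) (FiberBundle.contMDiffAt_extend I E Y)
  rw [FiberBundle.extend_apply_self, FiberBundle.extend_apply_self] at h
  exact h

end Curvature

end PontryaginForm

end

/-! ### The two formulas for the Pontryagin form -/

open PontryaginForm in
theorem mainTheorem2 (k l : ℕ) (hl : 2 * k ≤ l)
    -- an oriented Riemannian manifold `M` of dimension `4k`
    {M : Type*} [TopologicalSpace M] [T2Space M]
    [ChartedSpace (EuclideanSpace ℝ (Fin (4 * k))) M] [IsManifold (𝓡 (4 * k)) ∞ M]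
    [RiemannianBundle (fun x : M => TangentSpace (𝓡 (4 * k)) x)]
    [IsContMDiffRiemannianBundle (𝓡 (4 * k)) ∞ (EuclideanSpace ℝ (Fin (4 * k)))
      (fun x : M => TangentSpace (𝓡 (4 * k)) x)]
    (oM : BundleOrientation (4 * k) (EuclideanSpace ℝ (Fin (4 * k)))
      (fun x : M => TangentSpace (𝓡 (4 * k)) x))
    -- a smooth real vector bundle `V` of rank `l` over `M` with a smooth inner product
    {F : Type*} [NormedAddCommGroup F] [NormedSpace ℝ F] [FiniteDimensional ℝ F]
    (hF : finrank ℝ F = l)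
    {V : M → Type*} [TopologicalSpace (TotalSpace F V)]
    [∀ x, NormedAddCommGroup (V x)] [∀ x, InnerProductSpace ℝ (V x)]
    [∀ x, FiniteDimensional ℝ (V x)]
    [FiberBundle F V] [VectorBundle ℝ F V] [ContMDiffVectorBundle ∞ F V (𝓡 (4 * k))]
    [IsContMDiffRiemannianBundle (𝓡 (4 * k)) ∞ F V]
    -- a smooth connection compatible with the inner product
    (D : CovariantDerivative (𝓡 (4 * k)) F V) [D.ContMDiffCovariantDerivative ∞]
    (hD : D.IsMetricCompatible) :
    (∀ (x : M) (s : Basis (Fin l) ℝ (V x)),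
      let ε := oM.vol finrank_euclideanSpace_fin x
      pontryaginForm D k x s =
        (1 / ((2 * Real.pi) ^ (2 * k) * (k.factorial : ℝ) ^ 2) *
          (‖leftPart (selfDual ε (2 * k)) (curvaturePow D k x)‖ ^ 2 -
            ‖leftPart (antiSelfDual ε (2 * k)) (curvaturePow D k x)‖ ^ 2)) • ε) ∧
    (l = 4 * k → ∀ (oV : BundleOrientation l F V) (x : M) (s : Basis (Fin l) ℝ (V x)),
      let ε := oM.vol finrank_euclideanSpace_fin x
      let ε' := oV.vol hF x
      pontryaginForm D k x s =
        (1 / ((2 * Real.pi) ^ (2 * k) * (k.factorial : ℝ) ^ 2) *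
          (‖bothParts (selfDual ε (2 * k)) (selfDual ε' (2 * k)) (curvaturePow D k x)‖ ^ 2 +
            ‖bothParts (selfDual ε (2 * k)) (antiSelfDual ε' (2 * k)) (curvaturePow D k x)‖ ^ 2 -
            ‖bothParts (antiSelfDual ε (2 * k)) (selfDual ε' (2 * k)) (curvaturePow D k x)‖ ^ 2 -
            ‖bothParts (antiSelfDual ε (2 * k)) (antiSelfDual ε' (2 * k))
              (curvaturePow D k x)‖ ^ 2)) • ε) := by
  have hleft (x : M) (s : Basis (Fin l) ℝ (V x)) :
      pontryaginForm D k x s =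
        (1 / ((2 * Real.pi) ^ (2 * k) * (k.factorial : ℝ) ^ 2) *
          (‖leftPart (selfDual (oM.vol finrank_euclideanSpace_fin x) (2 * k))
              (curvaturePow D k x)‖ ^ 2 -
            ‖leftPart (antiSelfDual (oM.vol finrank_euclideanSpace_fin x) (2 * k))
              (curvaturePow D k x)‖ ^ 2)) • oM.vol finrank_euclideanSpace_fin x := by
    -- At a fixed point only linear algebra remains, and skewness of the curvature endomorphism is
    -- the one geometric input.
    have h := sum_minors_eq
      ((VectorBundle.finrank_eq ℝ _ (fun x : M => TangentSpace (𝓡 (4 * k)) x) x).trans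
        finrank_euclideanSpace_fin) (oM.fibre x) (curvatureEnd D x)
      (inner_curvatureAt D hD x) s
    have hc (a b c : ℝ) : 1 / a * (1 / b * c) = 1 / (a * b) * c := by
      rw [← mul_assoc, one_div_mul_one_div]
    exact (congrArg (fun η => (1 / (2 * Real.pi) ^ (2 * k) : ℝ) • η) h).trans
      ((smul_smul _ _ _).trans (congrArg (fun c : ℝ => c • oM.vol finrank_euclideanSpace_fin x)
        (hc _ _ _)))
  refine ⟨hleft, ?_⟩
  rintro rfl oV x s
  have hA (A : Submodule ℝ (Form (2 * k) (TangentSpace (𝓡 (4 * k)) x))) :=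
    norm_sq_bothParts_add ((VectorBundle.finrank_eq ℝ F V x).trans hF) (oV.fibre x)
      (by ring : 2 * k + 2 * k = 4 * k) (even_two_mul k) A (curvaturePow D k x)
  refine (hleft x s).trans ?_
  -- Split first the self-dual, then the anti-self-dual norm along the fibre factor.
  rw [← hA, ← hA, sub_sub]
  rfl
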